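/- A $k$-counter machine is a finite-state machine with a two-way read-only input head on a tape bordered by end-markers and with $k$ unbounded counters over $\mathbb{N}$. In one step it may, depending on its state, the tape symbol read and which counters are zero, change its state, move its head by at most one position, and change each counter by at most one. It starts on the first position to the right of the left end-marker with all counters zero, and it accepts by entering a final state. Machines may be nondeterministic. Let $$L=\{x\$x^T \mid x\in\{0,1\}^*\}$$ be the language of marked palindromes, where $x^T$ is the reversal of $x$. **Theorem (no linear speed-up).** Let $k\ge 2$ be fixed. 1. There is a deterministic $k$-counter machine that accepts exactly $L$ and halts on every input of length $n$ within $O(n^2/\log n)$ steps. 2. Machines with $k$ counters that accept $L$ in $O(n^2/\log n)$ steps have no linear speed-up: for every time bound $T(n)=O(n^2/\log n)$ there is a constant $c>0$, depending only on $k$ and $T$, such that no $k$-counter machine, deterministic or nondeterministic, accepts $L$ in $n+c\,T(n)$ steps. More precisely, for every $k$-counter machine $M$ accepting exactly $L$ and for every sufficiently large odd $n$, there is a word $w\in L$ of length $n$ that $M$ does not accept within $n+c\,T(n)$ steps. -/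

import Mathlib

/-- What the input head can see: an end-marker or an input symbol. -/
inductive TapeSymbol (α : Type) where
  | leftEnd : TapeSymbol α
  | letter : α → TapeSymbol α
  | rightEnd : TapeSymbol α

/-- A two-way machine with `k` (unbounded) counters over the input alphabet `α`.
Depending on the state, the tape symbol under the head and on which counters are zero
(`true` means that the counter is zero), a move consists of a new state, a head movement
and, for each counter, an increment, a decrement or no change. The machine may be
nondeterministic; an empty set of moves means that it halts. -/
structure CounterMachine (α : Type) (k : ℕ) where
  State : Type
  finite_state : Finite State
  start : State
  final : Set State
  moves : State → TapeSymbol α → (Fin k → Bool) → Set (State × SignType × (Fin k → SignType))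

namespace CounterMachine

variable {α : Type} {k : ℕ}

/-- A machine is deterministic if at most one move is possible in every situation. -/
def Deterministic (M : CounterMachine α k) : Prop :=
  ∀ q a z, (M.moves q a z).Subsingleton

/-- On an input of length `n` the head positions are `0, …, n + 1`: position `0` holds the left
end-marker, position `n + 1` the right one, and position `i` with `1 ≤ i ≤ n` the `i`-th symbol. -/
def tape (w : List α) : ℕ → TapeSymbol α
  | 0 => TapeSymbol.leftEnd
  | i + 1 => match w[i]? with
    | some a => TapeSymbol.letter a
    | none => TapeSymbol.rightEnd

/-- A configuration: state, head position, counter contents. -/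
@[ext]
structure Config (M : CounterMachine α k) where
  state : M.State
  head : ℕ
  counters : Fin k → ℕ

/-- Initially the head is next to the left end-marker and all counters are zero. -/
def initial (M : CounterMachine α k) : M.Config :=
  ⟨M.start, 1, fun _ => 0⟩

/-- The configuration after a given move. The head does not move beyond the end-markers, and
decrementing a counter that is zero leaves it at zero. -/
def apply (M : CounterMachine α k) (w : List α) (c : M.Config)
    (m : M.State × SignType × (Fin k → SignType)) : M.Config where
  state := m.1
  head := min ((c.head : ℤ) + (m.2.1 : ℤ)).toNat (w.length + 1)
  counters := fun i => ((c.counters i : ℤ) + (m.2.2 i : ℤ)).toNat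

/-- One step of the machine on the input `w`. -/
def Step (M : CounterMachine α k) (w : List α) (c c' : M.Config) : Prop :=
  ∃ m ∈ M.moves c.state (tape w c.head) (fun i => decide (c.counters i = 0)), c' = M.apply w c m

/-- Some computation on the input `w` is in the given configuration after exactly `t` steps. -/
def Reaches (M : CounterMachine α k) (w : List α) : ℕ → M.Config → Prop
  | 0, c => c = M.initial
  | t + 1, c => ∃ b, M.Reaches w t b ∧ M.Step w b c

/-- Some computation on the input `w` enters a final state after at most `t` steps. -/
def AcceptsWithin (M : CounterMachine α k) (w : List α) (t : ℝ) : Prop :=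
  ∃ j : ℕ, (j : ℝ) ≤ t ∧ ∃ c, M.Reaches w j c ∧ c.state ∈ M.final

/-- The language of all inputs on which some computation enters a final state. -/
def language (M : CounterMachine α k) : Language α :=
  {w | ∃ j c, M.Reaches w j c ∧ c.state ∈ M.final}

/-- On every input of length `n` every computation halts after at most `T n` steps. -/
def HaltsWithin (M : CounterMachine α k) (T : ℕ → ℝ) : Prop :=
  ∀ w j c, M.Reaches w j c → (j : ℝ) ≤ T w.length

end CounterMachine

/-- The alphabet `{0, 1, $}`. -/
inductive MarkedLetter where
  | bit : Bool → MarkedLetter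
  | mark : MarkedLetter

/-- The language of marked palindromes `x $ xᵀ` with `x` a binary word. -/
def markedPalindromes : Language MarkedLetter :=
  {w | ∃ x : List Bool,
    w = x.map MarkedLetter.bit ++ MarkedLetter.mark :: x.reverse.map MarkedLetter.bit}

/-! Lower bound. Cut an accepting computation at the boundary behind position `i` and record state
and counters at each crossing. If two marked palindromes of equal length have the same crossing
sequence there, then the left part of one followed by the right part of the other is accepted too
(`Trace.paste`), which for `i ≤ m` forces their first `i` letters to agree
(`take_eq_of_mem_markedPalindromes`); here `n = 2 * m + 1`. In `N` steps all counters stay at most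
`N`, and one of the boundaries in `(m / 2, m]` is crossed at most `r`, roughly `4 * N / n`, times.
Hence the half-word `x` is determined by that boundary, a crossing sequence of at most `r` entries,
and the letters of `x` behind position `m / 2` (`two_pow_le_of_accepts`). An entry carries `O(log
n)` bits, so if `N` is a small multiple of `n ^ 2 / log n`, fewer than `m / 2` bits have to describe
the first half of `x`, which is impossible. The summand `n` is negligible against `n ^ 2 / log n`.

Upper bound. Two counters suffice. After checking that the mark is in the middle, the machine
compares the two sides in blocks, from the mark outwards. The letters of a block are stored in a
counter as a binary code with a leading 1. The block ends when its code exceeds the distance to the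
mark: the walk to the mark that detects this also measures the distance, so the head can go on to
the mirror position with the code intact. There the code is halved digit by digit against the
letters. Codes stay `O(n)` and double with each letter, so a block costs `O(n)` by a geometric sum
(`decides_or_next_block`). A block ending at distance `d` has length at least about `log d`, so
there are `O(n / log n)` blocks (`decides_agree`). -/

namespace CounterMachine

/-! ### Crossing sequences and cut and paste. -/

variable {α : Type} {k : ℕ} {M : CounterMachine α k}

/-- `M.Trace w i c s` says that some accepting computation on `w` starts in the configuration `c`
and has the crossing sequence `s` at the boundary between the positions `i` and `i + 1`; for each
crossing the sequence records the state and the counters right after it. -/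
inductive Trace (M : CounterMachine α k) (w : List α) (i : ℕ) :
    M.Config → List (M.State × (Fin k → ℕ)) → Prop
  | done {c} : c.state ∈ M.final → Trace M w i c []
  | stay {c c' s} : M.Step w c c' → (c.head ≤ i ↔ c'.head ≤ i) → Trace M w i c' s →
      Trace M w i c s
  | cross {c c' s} : M.Step w c c' → ¬(c.head ≤ i ↔ c'.head ≤ i) → Trace M w i c' s →
      Trace M w i c ((c'.state, c'.counters) :: s)

/-- Some computation that starts in the configuration `c` is accepting. -/
def AcceptsFrom (M : CounterMachine α k) (w : List α) (c : M.Config) : Prop :=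
  ∃ c', Relation.ReflTransGen (M.Step w) c c' ∧ c'.state ∈ M.final

theorem AcceptsFrom.of_step {w : List α} {c c' : M.Config} (h : M.Step w c c')
    (h' : M.AcceptsFrom w c') : M.AcceptsFrom w c :=
  let ⟨d, hd, hf⟩ := h'
  ⟨d, .head h hd, hf⟩

theorem mem_language_of_acceptsFrom {w : List α} (h : M.AcceptsFrom w M.initial) :
    w ∈ M.language := by
  obtain ⟨d, hd, hf⟩ := h
  suffices ∃ j, M.Reaches w j d from let ⟨j, hj⟩ := this; ⟨j, d, hj, hf⟩
  induction hd with
  | refl => exact ⟨0, rfl⟩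
  | @tail b c _ hbc ih =>
    have hb : ∃ j, M.Reaches w j b := by
      clear hf
      rename_i hab
      clear ih hbc
      induction hab with
      | refl => exact ⟨0, rfl⟩
      | tail _ h ih => exact let ⟨j, hj⟩ := ih; ⟨j + 1, _, hj, h⟩
    obtain ⟨j, hj⟩ := hb
    exact ⟨j + 1, b, hj, hbc⟩

theorem tape_append_left (u v v' : List α) {p : ℕ} (hp : p ≤ u.length) :
    tape (u ++ v) p = tape (u ++ v') p := by
  cases p with
  | zero => rfl
  | succ p =>
    simp only [tape]
    rw [List.getElem?_append_left (by omega), List.getElem?_append_left (by omega)]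

theorem tape_append_right {u u' : List α} (v : List α) (h : u.length = u'.length) {p : ℕ}
    (hp : u.length < p) : tape (u ++ v) p = tape (u' ++ v) p := by
  cases p with
  | zero => omega
  | succ p =>
    simp only [tape]
    rw [List.getElem?_append_right (by omega), List.getElem?_append_right (by omega), h]

/-- A step sees the input only through the scanned symbol and through the length, which stops the
head at the right end-marker. -/
theorem Step.congr {w w' : List α} {c c' : M.Config} (h : M.Step w c c')
    (hl : w.length = w'.length) (ht : tape w c.head = tape w' c.head) : M.Step w' c c' := by
  obtain ⟨m, hm, rfl⟩ := h
  exact ⟨m, ht ▸ hm, by simp [apply, hl]⟩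

theorem Step.head_le {w : List α} {c c' : M.Config} (h : M.Step w c c') :
    c'.head ≤ w.length + 1 := by
  obtain ⟨m, -, rfl⟩ := h
  exact min_le_right _ _

theorem signType_cast_bounds (s : SignType) : -1 ≤ (s : ℤ) ∧ (s : ℤ) ≤ 1 := by
  cases s <;> simp

/-- The `min` in `apply` would pull a head from far beyond the right end-marker back by more than
one position; `hc` excludes this. -/
theorem Step.head_bounds {w : List α} {c c' : M.Config} (h : M.Step w c c')
    (hc : c.head ≤ w.length + 1) : c'.head ≤ c.head + 1 ∧ c.head ≤ c'.head + 1 := by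
  obtain ⟨m, -, rfl⟩ := h
  have := signType_cast_bounds m.2.1
  simp only [apply]
  omega

theorem Step.counters_le {w : List α} {c c' : M.Config} (h : M.Step w c c') (l : Fin k) :
    c'.counters l ≤ c.counters l + 1 := by
  obtain ⟨m, -, rfl⟩ := h
  have := signType_cast_bounds (m.2.2 l)
  simp only [apply]
  omega

theorem Reaches.bounds {w : List α} {t : ℕ} {c : M.Config} (h : M.Reaches w t c) :
    c.head ≤ w.length + 1 ∧ ∀ l, c.counters l ≤ t := by
  induction t generalizing c with
  | zero => cases h; simp [initial]
  | succ t ih =>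
    obtain ⟨b, hb, hs⟩ := h
    exact ⟨hs.head_le, fun l => (hs.counters_le l).trans (by have := (ih hb).2 l; omega)⟩

/-- Cut and paste. -/
theorem Trace.paste {u u' v v' : List α} (hu : u.length = u'.length) (hv : v.length = v'.length)
    {c c' : M.Config} {s : List (M.State × (Fin k → ℕ))}
    (hc : M.Trace (u ++ v) u.length c s) (hc' : M.Trace (u' ++ v') u.length c' s)
    (hb : c.head ≤ (u ++ v).length + 1) (hb' : c'.head ≤ (u ++ v).length + 1) :
    (c.head ≤ u.length → c'.head ≤ u.length → M.AcceptsFrom (u ++ v') c) ∧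
    (u.length < c.head → u.length < c'.head → M.AcceptsFrom (u ++ v') c') := by
  have hlen : (u ++ v).length = (u ++ v').length := by simp [hv]
  have hlen' : (u' ++ v').length = (u ++ v').length := by simp [hu]
  have left {c d : M.Config} (h : M.Step (u ++ v) c d) (hc : c.head ≤ u.length) :
      M.Step (u ++ v') c d := h.congr hlen (tape_append_left _ _ _ hc)
  have right {c d : M.Config} (h : M.Step (u' ++ v') c d) (hc : u.length < c.head) :
      M.Step (u ++ v') c d := h.congr hlen' (tape_append_right _ hu.symm (hu ▸ hc))
  -- The combined run imitates the first computation left of the boundary and the second one right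
  -- of it. The computation that is not imitated advances silently to its next crossing.
  induction hc generalizing c' with
  | @done c hf =>
    refine ⟨fun _ _ => ⟨c, .refl, hf⟩, ?_⟩
    generalize hs : ([] : List (M.State × (Fin k → ℕ))) = s at hc'
    clear hb
    induction hc' with
    | done hf => exact fun _ _ => ⟨_, .refl, hf⟩
    | stay h hh _ ih =>
      exact fun h1 h2 => (ih (by have := h.head_le; omega) hs h1 (by omega)).of_step (right h h2)
    | cross => cases hs
  | @stay c d s h hh _ ih =>
    have ih := ih hc' h.head_le hb'
    exact ⟨fun h1 h2 => (ih.1 (by omega) h2).of_step (left h h1),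
      fun h1 h2 => ih.2 (by omega) h2⟩
  | @cross c d s h hh _ ih =>
    generalize hs : (d.state, d.counters) :: s = s' at hc'
    induction hc' with
    | done hf => cases hs
    | @stay c' d' s' h' hh' _ ih' =>
      have ih' := ih' (by have := h'.head_le; omega) hs
      exact ⟨fun h1 h2 => ih'.1 h1 (by omega),
        fun h1 h2 => (ih'.2 h1 (by omega)).of_step (right h' h2)⟩
    | @cross c' d' s' h' hh' ht' _ =>
      simp only [List.cons.injEq, Prod.mk.injEq] at hs
      obtain ⟨⟨hs1, hs2⟩, rfl⟩ := hs
      have b := h.head_bounds hb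
      have b' := h'.head_bounds (by omega)
      have hd' := h'.head_le
      have ih := ih ht' h.head_le (by omega)
      refine ⟨fun h1 h2 => ?_, fun h1 h2 => ?_⟩
      -- The crossing sequence fixes state and counters; crossing by a single position fixes the
      -- head. So the two computations meet here and the roles change.
      · have : d = d' := Config.ext hs1 (by omega) hs2
        subst this
        exact (ih.2 (by omega) (by omega)).of_step (left h h1)
      · have : d = d' := Config.ext hs1 (by omega) hs2
        subst this
        exact (ih.1 (by omega) (by omega)).of_step (right h' h2)

/-- An accepting computation of `j` steps has crossing sequences of total length at most `j`. -/
theorem Reaches.exists_trace {w : List α} {j : ℕ} {c : M.Config} (h : M.Reaches w j c)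
    (hf : c.state ∈ M.final) : ∃ s : ℕ → List (M.State × (Fin k → ℕ)),
      (∀ i, M.Trace w i M.initial (s i)) ∧ (∀ i, ∀ p ∈ s i, ∀ l, p.2 l ≤ j) ∧
      ∀ I : Finset ℕ, ∑ i ∈ I, (s i).length ≤ j := by
  -- The computation is extended backwards: `r` bounds the crossings after `c`, and each of the `t`
  -- steps before `c` adds at most one.
  suffices H : ∀ (t r N : ℕ) (c : M.Config), M.Reaches w t c → t ≤ N →
      (∃ s : ℕ → List (M.State × (Fin k → ℕ)), (∀ i, M.Trace w i c (s i)) ∧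
        (∀ i, ∀ p ∈ s i, ∀ l, p.2 l ≤ N) ∧ ∀ I : Finset ℕ, ∑ i ∈ I, (s i).length ≤ r) →
      ∃ s : ℕ → List (M.State × (Fin k → ℕ)), (∀ i, M.Trace w i M.initial (s i)) ∧
        (∀ i, ∀ p ∈ s i, ∀ l, p.2 l ≤ N) ∧ ∀ I : Finset ℕ, ∑ i ∈ I, (s i).length ≤ r + t by
    simpa using H j 0 j c h le_rfl ⟨fun _ => [], fun i => .done hf, by simp, by simp⟩
  intro t
  induction t with
  | zero => rintro r N c rfl - h; exact h
  | succ t ih =>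
    rintro r N c ⟨b, hb, hs⟩ htN ⟨s, hs1, hs2, hs3⟩
    rw [add_comm t, ← add_assoc]
    have hbb := hb.bounds
    refine ih (r + 1) N b hb (by omega)
      ⟨fun i => if b.head ≤ i ↔ c.head ≤ i then s i else (c.state, c.counters) :: s i,
        fun i => ?_, fun i p hp l => ?_, fun I => ?_⟩
    · dsimp only
      split_ifs with h
      · exact .stay hs h (hs1 i)
      · exact .cross hs h (hs1 i)
    · dsimp only at hp
      split_ifs at hp with h
      · exact hs2 i p hp l
      · rcases List.mem_cons.1 hp with rfl | hp
        · have := hs.counters_le l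
          have := hbb.2 l
          simp only
          omega
        · exact hs2 i p hp l
    -- Moving between neighbouring positions crosses only the boundary behind the smaller one.
    · have hle : ∀ i ∈ I, (if b.head ≤ i ↔ c.head ≤ i then s i
          else (c.state, c.counters) :: s i).length ≤
          (s i).length + if i = min b.head c.head then 1 else 0 := by
        intro i _
        have := hs.head_bounds hbb.1
        by_cases h : b.head ≤ i ↔ c.head ≤ i
        · simp [h]
        · rw [if_neg h, if_pos (by omega)]
          simp
      refine (Finset.sum_le_sum hle).trans ?_
      rw [Finset.sum_add_distrib]
      have := hs3 I
      rw [Finset.sum_ite_eq']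
      split_ifs <;> omega

end CounterMachine

/-! ### Mixing two marked palindromes; encoding crossing sequences. -/

/-- The marked palindrome with the first half `x`. -/
def markedPalindrome (x : List Bool) : List MarkedLetter :=
  x.map MarkedLetter.bit ++ MarkedLetter.mark :: x.reverse.map MarkedLetter.bit

theorem mem_markedPalindromes {w : List MarkedLetter} :
    w ∈ markedPalindromes ↔ ∃ x, w = markedPalindrome x := Iff.rfl

theorem length_markedPalindrome (x : List Bool) :
    (markedPalindrome x).length = 2 * x.length + 1 := by
  simp [markedPalindrome]; omega

theorem bit_injective : Function.Injective MarkedLetter.bit := fun a b h => by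
  injection h

/-- If the first `i` letters of one marked palindrome fit to the rest of another one, with `i`
at most the length of their first halves, then they agree. -/
theorem take_eq_of_mem_markedPalindromes {x y : List Bool} (hl : x.length = y.length) {i : ℕ}
    (hi : i ≤ y.length)
    (h : (markedPalindrome x).take i ++ (markedPalindrome y).drop i ∈ markedPalindromes) :
    x.take i = y.take i := by
  obtain ⟨z, hz⟩ := mem_markedPalindromes.1 h
  have e : (markedPalindrome x).take i ++ (markedPalindrome y).drop i =
      (x.take i ++ y.drop i).map MarkedLetter.bit ++
        MarkedLetter.mark :: y.reverse.map MarkedLetter.bit := by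
    rw [markedPalindrome, markedPalindrome, List.take_append_of_le_length (by simp; omega),
      List.drop_append_of_le_length (by simp; omega)]
    simp
  have hlen := congrArg List.length hz
  rw [length_markedPalindrome, e] at hlen
  rw [e, markedPalindrome] at hz
  simp only [List.length_append, List.length_map, List.length_take, List.length_drop,
    List.length_cons, List.length_reverse] at hlen
  obtain ⟨h1, h2⟩ := List.append_inj hz (by simp; omega)
  have h1 := List.map_injective_iff.2 bit_injective h1
  have h2 := List.map_injective_iff.2 bit_injective (List.cons.inj h2).2
  -- The part behind the mark comes from `y` alone, so the mixed word can only be the palindrome of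
  -- `y`.
  rw [List.reverse_inj] at h2
  rw [← h2] at h1
  have := congrArg (List.take i) h1
  rwa [List.take_append_of_le_length (by simp; omega), List.take_take, min_self] at this

/-- There are at most `(q + 1) ^ r` lists of length at most `r` over `q` letters. -/
theorem exists_encoding_of_length_le {S : Type} {k : ℕ} (N r : ℕ) :
    ∃ enc : List (S × (Fin k → ℕ)) → Fin r → Option (S × (Fin k → Fin (N + 1))),
      Set.InjOn enc {s | s.length ≤ r ∧ ∀ p ∈ s, ∀ l, p.2 l ≤ N} := by
  -- Short lists are padded with `none`; the reduction modulo `N + 1` loses nothing for entries at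
  -- most `N`.
  refine ⟨fun s a => s[(a : ℕ)]?.map fun p => (p.1, fun l => Fin.ofNat (N + 1) (p.2 l)), ?_⟩
  rintro s ⟨hs, hs'⟩ t ⟨ht, ht'⟩ h
  apply List.ext_getElem?
  intro a
  by_cases ha : a < r
  · have h := congrFun h ⟨a, ha⟩
    dsimp only at h
    cases h1 : s[a]? with
    | none =>
      cases h2 : t[a]? with
      | none => rfl
      | some q => simp [h1, h2] at h
    | some p =>
      cases h2 : t[a]? with
      | none => simp [h1, h2] at h
      | some q =>
        simp only [h1, h2, Option.map_some, Option.some.injEq, Prod.mk.injEq] at h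
        refine congrArg some (Prod.ext h.1 (funext fun l => ?_))
        have hl := congrArg Fin.val (congrFun h.2 l)
        have hp := hs' p (List.mem_of_getElem? h1) l
        have hq := ht' q (List.mem_of_getElem? h2) l
        simpa [Fin.ofNat, Nat.mod_eq_of_lt (Nat.lt_succ_of_le hp),
          Nat.mod_eq_of_lt (Nat.lt_succ_of_le hq)] using hl
  · rw [List.getElem?_eq_none (by omega), List.getElem?_eq_none (by omega)]

/-! ### The counting argument. -/

namespace CounterMachine

/-- The counting argument: if all marked palindromes of length `2 * m + 1` are accepted within `N`
steps, then there are many crossing sequences of length at most `N / (m - h)`. -/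
theorem two_pow_le_of_accepts {k : ℕ} {M : CounterMachine MarkedLetter k}
    (hM : M.language = markedPalindromes) {m h N r : ℕ} (hr : N < (r + 1) * (m - h))
    (hacc : ∀ x : List Bool, x.length = m → ∃ j ≤ N, ∃ c, M.Reaches (markedPalindrome x) j c ∧
      c.state ∈ M.final) :
    2 ^ m ≤ (m + 1) * (Nat.card M.State * (N + 1) ^ k + 1) ^ r * 2 ^ (m - h) := by
  have key : ∀ x : List.Vector Bool m, ∃ (i : ℕ) (s : List (M.State × (Fin k → ℕ))),
      (h < i ∧ i ≤ m) ∧ M.Trace (markedPalindrome x.1) i M.initial s ∧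
      s.length ≤ r ∧ ∀ p ∈ s, ∀ l, p.2 l ≤ N := by
    intro x
    obtain ⟨j, hj, c, hc, hf⟩ := hacc x.1 x.2
    obtain ⟨s, h1, h2, h3⟩ := hc.exists_trace hf
    -- Averaging: the `m - h` boundaries share at most `N < (r + 1) * (m - h)` crossings.
    have : ∃ i ∈ Finset.Ioc h m, (s i).length ≤ r := by
      by_contra! hcon
      have := Finset.card_nsmul_le_sum (Finset.Ioc h m) (fun i => (s i).length) (r + 1)
        (fun i hi => hcon i hi)
      have h3 := h3 (Finset.Ioc h m)
      rw [Nat.card_Ioc, smul_eq_mul, mul_comm] at this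
      omega
    obtain ⟨i, hi, hs⟩ := this
    exact ⟨i, s i, Finset.mem_Ioc.1 hi, h1 i, hs, fun p hp l => (h2 i p hp l).trans hj⟩
  choose i s hi ht hs hN using key
  obtain ⟨enc, henc⟩ := exists_encoding_of_length_le (S := M.State) (k := k) N r
  -- The boundary lies beyond `h`, so `x.drop h` contains all letters of `x` right of it, and its
  -- type does not depend on the boundary. The letters to the left are recovered by cut and paste.
  let f : List.Vector Bool m →
      (Fin (m + 1) × (Fin r → Option (M.State × (Fin k → Fin (N + 1))))) ×
        List.Vector Bool (m - h) :=
    fun x => ((⟨i x, by have := hi x; omega⟩, enc (s x)), x.drop h)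
  have hf : Function.Injective f := by
    intro x y hxy
    simp only [f, Prod.mk.injEq, Fin.mk.injEq] at hxy
    obtain ⟨⟨hi', he⟩, hd⟩ := hxy
    have he : s x = s y := henc ⟨hs x, hN x⟩ ⟨hs y, hN y⟩ he
    have hd : x.1.drop h = y.1.drop h := congrArg Subtype.val hd
    have hx := hi x
    have hxl := x.2
    have hyl := y.2
    have lx : ((markedPalindrome x.1).take (i x)).length = i x := by
      simp [length_markedPalindrome]; omega
    have ly : ((markedPalindrome y.1).take (i x)).length = i x := by
      simp [length_markedPalindrome]; omega
    have tx := ht x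
    have ty := ht y
    rw [← hi', ← he] at ty
    rw [← List.take_append_drop (i x) (markedPalindrome x.1)] at tx
    rw [← List.take_append_drop (i x) (markedPalindrome y.1)] at ty
    nth_rw 3 [← lx] at tx
    nth_rw 3 [← lx] at ty
    have := Trace.paste (lx.trans ly.symm) (by simp [length_markedPalindrome, hxl, hyl]) tx ty
      (by simp [initial]) (by simp [initial])
    have := mem_language_of_acceptsFrom
      (this.1 (by simp only [initial]; omega) (by simp only [initial]; omega))
    rw [hM] at this
    have := take_eq_of_mem_markedPalindromes (hxl.trans hyl.symm) (by omega) this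
    have h2 : x.1.drop (i x) = y.1.drop (i x) := by
      have h3 := congrArg (List.drop (i x - h)) hd
      rwa [List.drop_drop, List.drop_drop, Nat.add_sub_cancel' hx.1.le] at h3
    apply Subtype.ext
    rw [← List.take_append_drop (i x) x.1, this, h2, List.take_append_drop]
  have := M.finite_state
  have hcard := Nat.card_le_card_of_injective f hf
  simpa [Nat.card_prod, Nat.card_eq_fintype_card (α := List.Vector _ _), card_vector,
    Nat.card_fun, Finite.card_option] using hcard

end CounterMachine

/-! ### Numerical estimates and the lower bound. -/

namespace CounterMachine

/-- The inequality of the counting argument fails for large `m` if `N` is at most a small multiple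
of `n ^ 2 / log n`, where `n = 2 * m + 1`. -/
theorem lt_two_pow_of_le {k S m N : ℕ} {n δ : ℝ} (hn : n = 2 * m + 1)
    (hδ : δ = 1 / (400 * (2 * k + 1))) (hlog : Real.log n ≤ δ * n) (hn0 : 1000 ≤ n)
    (hS : (S : ℝ) + 1 ≤ n) (hN : (N : ℝ) ≤ n + δ * (n ^ 2 / Real.log n)) :
    (m + 1) * (S * (N + 1) ^ k + 1) ^ (N / (m - m / 2)) * 2 ^ (m - m / 2) < 2 ^ m := by
  have hδ0 : 0 < δ := by rw [hδ]; positivity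
  have hδk : δ * (400 * (2 * k + 1)) = 1 := by rw [hδ]; field_simp
  have hδ1 : δ ≤ 1 / 400 := by
    have : 0 ≤ δ * k := by positivity
    linarith
  have hl1 : 1 ≤ Real.log n := by
    rw [Real.le_log_iff_exp_le (by linarith)]
    linarith [Real.exp_one_lt_d9]
  have hN2 : (N : ℝ) ≤ 2 * δ * n ^ 2 / Real.log n := by
    -- The linear term is absorbed, at the cost of a factor 2.
    have : n ≤ δ * (n ^ 2 / Real.log n) := by
      rw [← mul_div_assoc, le_div_iff₀ (by linarith)]
      nlinarith
    calc (N : ℝ) ≤ _ := hN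
      _ ≤ δ * (n ^ 2 / Real.log n) + δ * (n ^ 2 / Real.log n) := by linarith
      _ = _ := by ring
  set g := m - m / 2 with hg
  have hgm : g ≤ m ∧ m ≤ 2 * g ∧ 2 * g ≤ m + 1 := by omega
  have hm1 : (m : ℝ) ≤ 2 * g := by exact_mod_cast hgm.2.1
  have hm2 : 2 * (g : ℝ) ≤ m + 1 := by exact_mod_cast hgm.2.2
  have hg5 : n / 5 ≤ g := by linarith
  have hr : ((N / g : ℕ) : ℝ) * Real.log n ≤ 10 * δ * n := by
    have hg0 : (0 : ℝ) < g := by linarith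
    have h1 : ((N / g : ℕ) : ℝ) ≤ N / g := Nat.cast_div_le
    rw [le_div_iff₀ hg0] at h1
    rw [le_div_iff₀ (by linarith)] at hN2
    have h2 : ((N / g : ℕ) : ℝ) * (n / 5) ≤ N :=
      (mul_le_mul_of_nonneg_left hg5 (Nat.cast_nonneg _)).trans h1
    have h3 : ((N / g : ℕ) : ℝ) * (n / 5) * Real.log n ≤ 2 * δ * n ^ 2 :=
      (mul_le_mul_of_nonneg_right h2 (by linarith)).trans hN2
    have h4 : n * (((N / g : ℕ) : ℝ) * Real.log n) ≤ n * (10 * δ * n) := by linarith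
    exact le_of_mul_le_mul_left h4 (by linarith)
  have hN1 : (N : ℝ) + 1 ≤ n ^ 2 := by
    have : 2 * δ * n ^ 2 / Real.log n ≤ 2 * δ * n ^ 2 := div_le_self (by positivity) hl1
    nlinarith
  have hP : ((S * (N + 1) ^ k + 1 : ℕ) : ℝ) ≤ n ^ (2 * k + 1) := by
    have h1 : (1 : ℝ) ≤ ((N : ℝ) + 1) ^ k := one_le_pow₀ (by linarith [Nat.cast_nonneg (α := ℝ) N])
    calc ((S * (N + 1) ^ k + 1 : ℕ) : ℝ) = S * ((N : ℝ) + 1) ^ k + 1 := by push_cast; ring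
      _ ≤ (S + 1) * ((N : ℝ) + 1) ^ k := by linarith
      _ ≤ n * (n ^ 2) ^ k := by gcongr
      _ = _ := by rw [← pow_mul, pow_succ]; ring
  have hlogP : Real.log (S * (N + 1) ^ k + 1 : ℕ) ≤ (2 * k + 1) * Real.log n := by
    refine (Real.log_le_log (by positivity) hP).trans_eq ?_
    rw [Real.log_pow]
    push_cast
    ring
  -- Each entry of a crossing sequence costs at most `(2 * k + 1) * log n`; the denominator of `δ`
  -- is chosen to cancel this factor.
  have hA : ((N / g : ℕ) : ℝ) * Real.log (S * (N + 1) ^ k + 1 : ℕ) ≤ n / 40 := by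
    calc _ ≤ ((N / g : ℕ) : ℝ) * ((2 * k + 1) * Real.log n) := by gcongr
      _ = (2 * k + 1) * (((N / g : ℕ) : ℝ) * Real.log n) := by ring
      _ ≤ (2 * k + 1) * (10 * δ * n) := by gcongr
      _ = δ * (400 * (2 * k + 1)) * (n / 40) := by ring
      _ = n / 40 := by rw [hδk, one_mul]
  have hB : Real.log ((m + 1 : ℕ) : ℝ) ≤ n / 400 := by
    refine (Real.log_le_log (by positivity) (?_ : _ ≤ n)).trans (hlog.trans ?_)
    · push_cast; linarith
    · nlinarith
  have hpos : 0 < (m + 1) * (S * (N + 1) ^ k + 1) ^ (N / g) * 2 ^ g := by positivity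
  have : Real.log (((m + 1) * (S * (N + 1) ^ k + 1) ^ (N / g) * 2 ^ g : ℕ) : ℝ) <
      Real.log ((2 ^ m : ℕ) : ℝ) := by
    rw [Nat.cast_mul, Nat.cast_mul, Nat.cast_pow, Nat.cast_pow, Nat.cast_pow,
      Real.log_mul (by positivity) (by positivity), Real.log_mul (by positivity) (by positivity),
      Real.log_pow, Real.log_pow, Real.log_pow]
    have := Real.log_two_gt_d9
    push_cast at hA hB ⊢
    -- The balance: `n / 400` for the boundary and `n / 40` for the crossing sequence, against at
    -- least `n / 10` for the letters that are not recorded.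
    have h5 : n / 5 * (1 / 2) ≤ (m - g : ℝ) * Real.log 2 :=
      mul_le_mul (by linarith) (by linarith) (by norm_num) (by linarith)
    linarith
  exact_mod_cast (Real.log_lt_log_iff (by exact_mod_cast hpos) (by positivity)).1 this

/-- Marked palindromes cannot be accepted in `n + c * T n` steps for small `c`. -/
theorem exists_not_acceptsWithin (k : ℕ) {T : ℕ → ℝ}
    (hT : T =O[Filter.atTop] (fun n : ℕ => (n : ℝ) ^ 2 / Real.log n)) :
    ∃ c : ℝ, 0 < c ∧ ∀ M : CounterMachine MarkedLetter k, M.language = markedPalindromes →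
      ∀ᶠ n : ℕ in Filter.atTop, Odd n →
        ∃ w ∈ markedPalindromes, w.length = n ∧ ¬ M.AcceptsWithin w ((n : ℝ) + c * T n) := by
  obtain ⟨C, hC, hTC⟩ := hT.exists_pos
  have hTC := hTC.bound
  set δ : ℝ := 1 / (400 * (2 * k + 1)) with hδ
  have hδ0 : 0 < δ := by positivity
  -- The constant is chosen before `M`; the number of states only affects how large `n` must be.
  refine ⟨δ / C, by positivity, fun M hM => ?_⟩
  have hlog := (Real.isLittleO_log_id_atTop.comp_tendsto
    (tendsto_natCast_atTop_atTop (R := ℝ))).bound hδ0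
  filter_upwards [hTC, hlog, Filter.eventually_ge_atTop 1000,
    Filter.eventually_ge_atTop (Nat.card M.State + 1)] with n h1 h2 h3 h4
  rintro ⟨m, hm⟩
  by_contra! hcon
  have h3' : (1000 : ℝ) ≤ n := by exact_mod_cast h3
  have hln : 0 ≤ Real.log n := Real.log_nonneg (by linarith)
  simp only [Function.comp, id, Real.norm_eq_abs, Nat.abs_cast, abs_of_nonneg hln] at h2
  have hq : 0 ≤ (n : ℝ) ^ 2 / Real.log n := by positivity
  rw [Real.norm_eq_abs, Real.norm_eq_abs, abs_of_nonneg hq] at h1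
  set N := ⌊(n : ℝ) + δ / C * T n⌋₊ with hNdef
  have hle : (n : ℝ) + δ / C * T n ≤ n + δ * ((n : ℝ) ^ 2 / Real.log n) := by
    have : δ / C * T n ≤ δ / C * (C * ((n : ℝ) ^ 2 / Real.log n)) := by
      gcongr
      exact (le_abs_self _).trans h1
    rw [← mul_assoc, div_mul_cancel₀ _ hC.ne'] at this
    linarith
  have hN : (N : ℝ) ≤ n + δ * ((n : ℝ) ^ 2 / Real.log n) :=
    (Nat.cast_le.2 (Nat.floor_mono hle)).trans (Nat.floor_le (by positivity))
  have hlt := lt_two_pow_of_le (k := k) (S := Nat.card M.State) (m := m) (N := N) (n := n)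
    (by rw [hm]; push_cast; ring) hδ h2 h3' (by exact_mod_cast h4) hN
  refine hlt.not_ge (two_pow_le_of_accepts hM
    (by rw [mul_comm]; exact Nat.lt_mul_div_succ N (by omega)) fun x hx => ?_)
  have hl : (markedPalindrome x).length = n := by rw [length_markedPalindrome, hx, hm]
  obtain ⟨j, hj, c, hc, hf⟩ := hcon _ (mem_markedPalindromes.2 ⟨x, rfl⟩) hl
  exact ⟨j, Nat.le_floor hj, c, hc, hf⟩

end CounterMachine

/-! ### Runs of deterministic machines. -/

namespace CounterMachine

section Deciding

variable {α : Type} {k : ℕ} (M : CounterMachine α k) (w : List α)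

/-- From the configuration `c` the machine gets to `c'` within `N` steps. -/
def Within (N : ℕ) (c c' : M.Config) : Prop :=
  ∃ t ≤ N, ∀ s, M.Reaches w s c → M.Reaches w (s + t) c'

/-- From the configuration `c` the machine gets within `N` steps to a halting configuration,
which is final if and only if `P` holds. -/
def Decides (N : ℕ) (c : M.Config) (P : Prop) : Prop :=
  ∃ c', M.Within w N c c' ∧ (∀ d, ¬ M.Step w c' d) ∧ (c'.state ∈ M.final ↔ P)

variable {M w}

theorem Within.refl {N : ℕ} (c : M.Config) : M.Within w N c c :=
  ⟨0, N.zero_le, fun _ h => h⟩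

theorem Within.mono {N N' : ℕ} {c c' : M.Config} (h : M.Within w N c c') (hN : N ≤ N') :
    M.Within w N' c c' :=
  let ⟨t, ht, h⟩ := h
  ⟨t, ht.trans hN, h⟩

theorem Within.trans {N N' : ℕ} {c c' c'' : M.Config} (h : M.Within w N c c')
    (h' : M.Within w N' c' c'') : M.Within w (N + N') c c'' := by
  obtain ⟨t, ht, h⟩ := h
  obtain ⟨t', ht', h'⟩ := h'
  exact ⟨t + t', by omega, fun s hs => by rw [← add_assoc]; exact h' _ (h s hs)⟩

theorem Step.within {c c' : M.Config} (h : M.Step w c c') : M.Within w 1 c c' :=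
  ⟨1, le_rfl, fun _ hs => ⟨c, hs, h⟩⟩

theorem Within.decides {N N' : ℕ} {c c' : M.Config} {P : Prop} (h : M.Within w N c c')
    (h' : M.Decides w N' c' P) : M.Decides w (N + N') c P :=
  let ⟨d, hd, hh⟩ := h'
  ⟨d, h.trans hd, hh⟩

theorem Decides.mono {N N' : ℕ} {c : M.Config} {P : Prop} (h : M.Decides w N c P) (hN : N ≤ N') :
    M.Decides w N' c P :=
  let ⟨d, hd, hh⟩ := h
  ⟨d, hd.mono hN, hh⟩

theorem Deterministic.step_unique (hM : M.Deterministic) {b c c' : M.Config}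
    (h : M.Step w b c) (h' : M.Step w b c') : c = c' := by
  obtain ⟨m, hm, rfl⟩ := h
  obtain ⟨m', hm', rfl⟩ := h'
  rw [hM _ _ _ hm hm']

theorem Deterministic.reaches_unique (hM : M.Deterministic) {t : ℕ} {c c' : M.Config}
    (h : M.Reaches w t c) (h' : M.Reaches w t c') : c = c' := by
  induction t generalizing c c' with
  | zero => exact h.trans h'.symm
  | succ t ih =>
    obtain ⟨b, hb, hs⟩ := h
    obtain ⟨b', hb', hs'⟩ := h'
    cases ih hb hb'
    exact hM.step_unique hs hs'

theorem Reaches.exists_of_le {t s : ℕ} {c : M.Config} (h : M.Reaches w t c) (hs : s ≤ t) :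
    ∃ b, M.Reaches w s b := by
  induction t generalizing c with
  | zero => exact ⟨c, by rwa [Nat.le_zero.1 hs]⟩
  | succ t ih =>
    rcases hs.eq_or_lt with rfl | hs
    · exact ⟨c, h⟩
    · exact let ⟨b, hb, _⟩ := h; ih hb (by omega)

/-- A computation of a deterministic machine is not longer than a halting one. -/
theorem Deterministic.le_of_halts (hM : M.Deterministic) {t j : ℕ} {c d : M.Config}
    (h : M.Reaches w t c) (hc : ∀ d, ¬ M.Step w c d) (h' : M.Reaches w j d) : j ≤ t := by
  by_contra! hlt
  obtain ⟨b, b', hb', hs⟩ := h'.exists_of_le (Nat.succ_le_of_lt hlt)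
  cases hM.reaches_unique h hb'
  exact hc _ hs

/-- A deterministic machine that halts in final configurations recognizes what it decides. -/
theorem Deterministic.language_eq_and_haltsWithin (hM : M.Deterministic) {L : Language α}
    {T : ℕ → ℕ} (hd : ∀ w, M.Decides w (T w.length) M.initial (w ∈ L))
    (hf : ∀ w (c d : M.Config), c.state ∈ M.final → ¬ M.Step w c d) :
    M.language = L ∧ M.HaltsWithin fun n => (T n : ℝ) := by
  refine ⟨Set.ext fun w => ?_, fun w j c hj => ?_⟩
  · obtain ⟨c, ⟨t, -, ht⟩, hh, hc⟩ := hd w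
    have ht := ht 0 rfl
    rw [zero_add] at ht
    refine ⟨fun ⟨j, d, hj, hd⟩ => hc.1 ?_, fun h => ⟨t, c, ht, hc.2 h⟩⟩
    -- Both configurations are halting, so their times bound each other and coincide.
    have h1 := hM.le_of_halts ht hh hj
    have h2 := hM.le_of_halts hj (fun e => hf w d e hd) ht
    obtain rfl : j = t := by omega
    rwa [hM.reaches_unique ht hj]
  · obtain ⟨c, ⟨t, htT, ht⟩, hh, -⟩ := hd w
    have ht := ht 0 rfl
    rw [zero_add] at ht
    exact Nat.cast_le.2 ((hM.le_of_halts ht hh hj).trans htT)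

end Deciding

end CounterMachine

/-! ### The two-counter machine. -/

/-- The control states of a machine for marked palindromes. The parameter `side` tells on which
side of the mark the head works (`true` is the right one), `again` whether a block is read for the
second time, and `last` whether the end of the input was met. -/
inductive PalindromeState
  | countUp
  | countDown
  | seek
  | first (side again : Bool)
  | second (side again : Bool)
  | read (side again : Bool)
  | compare (side again last : Bool)
  | double (side again : Bool)
  | doubleMore (side again : Bool)
  | back (side again last : Bool)
  | halve (side last : Bool)
  | halveMore (side last : Bool)
  | restore (side last : Bool)
  | drain (side : Bool)
  | accept
  deriving Fintype

namespace PalindromeState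

/-- The direction away from the mark. -/
def outward (side : Bool) : SignType := if side then 1 else -1

/-- Whether the tape symbol is the mark. -/
def isMark : TapeSymbol MarkedLetter → Bool
  | .letter .mark => true
  | _ => false

/-- Whether the tape symbol is an end-marker. -/
def isEnd : TapeSymbol MarkedLetter → Bool
  | .letter _ => false
  | _ => true

/-- The bit on the tape; the mark and the end-markers count as `false`. -/
def bitOf : TapeSymbol MarkedLetter → Bool
  | .letter (.bit b) => b
  | _ => false

/-- The transition function, which works on the two counters `A` and `B`. The arguments `za` and
`zb` tell whether they are zero; the values are the new state, the head movement and the changes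
of `A` and `B`. First the machine checks that the mark is in the middle. Then it goes through the
input in blocks, from the mark outwards. A block is read on one side, and its binary code
(with a leading `1`) is collected in `A` until it exceeds the distance to the mark. The head goes
to the mirror image of its position, and compares the letters there with the digits of the code,
going towards the mark. Then it reads the block again and begins the next block. -/
def next : PalindromeState → TapeSymbol MarkedLetter → Bool → Bool →
    Option (PalindromeState × SignType × SignType × SignType)
  | countUp, .letter (.bit _), _, _ => some (countUp, 1, 1, 0)
  | countUp, .letter .mark, _, _ => some (countDown, 1, 0, 0)
  | countUp, _, _, _ => none
  | countDown, .letter (.bit _), false, _ => some (countDown, 1, -1, 0)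
  | countDown, .rightEnd, true, _ => some (seek, -1, 0, 0)
  | countDown, _, _, _ => none
  | seek, .letter .mark, _, _ => some (first false false, 0, 0, 0)
  | seek, _, _, _ => some (seek, -1, 0, 0)
  | first i f, _, _, _ => some (second i f, 0, 1, 0)
  | second i f, _, _, _ => some (read i f, outward i, 1, 0)
  | read i f, s, _, _ => some (compare i f (isEnd s), 0, if bitOf s then 1 else 0, 0)
  | compare i f _, _, true, _ => some (double i f, 0, 0, 0)
  -- If the end was met (`e`), the block stops however small its code is; `A` is then left
  -- unchanged, so that it stays positive up to the mark.
  | compare i f e, s, false, _ =>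
    if isMark s then some (back (if f then i else !i) f e, 0, 0, 0)
    else some (compare i f e, -outward i, if e then 0 else -1, 1)
  | double i f, _, _, true => some (read i f, outward i, 0, 0)
  | double i f, _, _, false => some (doubleMore i f, outward i, 1, -1)
  | doubleMore i f, _, _, _ => some (double i f, 0, 1, 0)
  | back i f e, _, _, true => some (if f then drain i else halve i e, 0, 0, 0)
  | back i f e, _, _, false => some (back i f e, outward i, if e then 0 else 1, -1)
  | halve i e, s, true, _ => if bitOf s then none else some (restore i e, -outward i, 0, 0)
  | halve i e, _, false, _ => some (halveMore i e, 0, -1, 0)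
  -- Quotient 0 with remainder 1: only the leading 1 was left, so the block is used up.
  | halveMore i e, _, true, true => some (if e then accept else first i true, 0, 0, 0)
  | halveMore i e, s, true, false =>
    if bitOf s then some (restore i e, -outward i, 0, 0) else none
  | halveMore i e, _, false, _ => some (halve i e, 0, -1, 1)
  | restore i e, _, _, true => some (halve i e, 0, 0, 0)
  | restore i e, _, _, false => some (restore i e, 0, 1, -1)
  | drain i, _, true, _ => some (first i false, 0, 0, 0)
  | drain i, _, false, _ => some (drain i, 0, -1, 0)
  | accept, _, _, _ => none

end PalindromeState

open PalindromeState CounterMachine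

/-- A deterministic machine for marked palindromes; only the first two counters are used. -/
def palindromeMachine (k : ℕ) : CounterMachine MarkedLetter (k + 2) where
  State := PalindromeState
  finite_state := inferInstance
  start := .countUp
  final := {.accept}
  moves q s z := {m | ∃ r ∈ next q s (z 0) (z 1),
    m = (r.1, r.2.1, Fin.cons r.2.2.1 (Fin.cons r.2.2.2 fun _ => 0))}

namespace palindromeMachine

variable {k : ℕ} {w : List MarkedLetter}

theorem deterministic : (palindromeMachine k).Deterministic := by
  rintro q s z _ ⟨r, hr, rfl⟩ _ ⟨r', hr', rfl⟩
  rw [Option.mem_unique hr hr']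

/-- The configuration with the given state, head position and values of the first two counters. -/
def config (k : ℕ) (q : PalindromeState) (h a b : ℕ) : (palindromeMachine k).Config :=
  ⟨q, h, Fin.cons a (Fin.cons b fun _ => 0)⟩

theorem initial_eq : (palindromeMachine k).initial = config k countUp 1 0 0 := by
  refine Config.ext rfl rfl (funext fun i => ?_)
  refine Fin.cases rfl (fun i => ?_) i
  exact Fin.cases rfl (fun i => rfl) i

/-- Stating the changes as identities in `ℤ` with natural results rules out the truncations in
`apply`. -/
theorem step {q q' : PalindromeState} {h a b h' a' b' : ℕ} {d da db : SignType}
    (hn : next q (tape w h) (decide (a = 0)) (decide (b = 0)) = some (q', d, da, db))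
    (hh : (h' : ℤ) = h + d) (hl : h' ≤ w.length + 1) (ha : (a' : ℤ) = a + da)
    (hb : (b' : ℤ) = b + db) :
    (palindromeMachine k).Within w 1 (config k q h a b) (config k q' h' a' b') := by
  refine Step.within ⟨_, ⟨(q', d, da, db), hn, rfl⟩, Config.ext rfl ?_ (funext fun i => ?_)⟩
  · simp only [config, apply, ← hh]
    simp [hl]
  · refine Fin.cases ?_ (fun i => ?_) i
    · simp [config, apply, ← ha]
    · refine Fin.cases ?_ (fun i => ?_) i
      · simp [config, apply, ← hb]
      · simp [config, apply]

theorem decides_of_next_eq_none {q : PalindromeState} {h a b N : ℕ} {P : Prop}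
    (hn : next q (tape w h) (decide (a = 0)) (decide (b = 0)) = none) (hP : q = accept ↔ P) :
    (palindromeMachine k).Decides w N (config k q h a b) P := by
  refine ⟨_, .refl _, fun c => ?_, hP⟩
  rintro ⟨_, ⟨r, hr, rfl⟩, -⟩
  exact absurd (hn.symm.trans hr) (by simp)

theorem not_step_of_final {c d : (palindromeMachine k).Config}
    (hc : c.state ∈ (palindromeMachine k).final) : ¬ (palindromeMachine k).Step w c d := by
  rintro ⟨_, ⟨r, hr, rfl⟩, -⟩
  rw [show c.state = accept from hc] at hr
  simp [next] at hr

end palindromeMachine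

/-! ### The loops of the machine on an input with the mark in the middle. -/

namespace palindromeMachine

/-- The input `w` consists of `m` bits, a mark and `m` bits. -/
structure Centered (w : List MarkedLetter) (m : ℕ) : Prop where
  length_eq : w.length = 2 * m + 1
  mark : tape w (m + 1) = .letter .mark
  bit : ∀ h, 1 ≤ h → h ≤ 2 * m + 1 → h ≠ m + 1 → ∃ b, tape w h = .letter (.bit b)

/-- The position on the given side at distance `d` from position `m + 1`. -/
def pos (m : ℕ) (i : Bool) (d : ℕ) : ℕ := if i then m + 1 + d else m + 1 - d

/-- The bit on the given side at distance `d` from position `m + 1`. -/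
def bitAt (w : List MarkedLetter) (m : ℕ) (i : Bool) (d : ℕ) : Bool := bitOf (tape w (pos m i d))

variable {k : ℕ} {w : List MarkedLetter} {m : ℕ}

theorem tape_eq_rightEnd {h : ℕ} (hh : h = w.length + 1) : tape w h = .rightEnd := by
  subst hh
  simp [tape]

namespace Centered

variable (hw : Centered w m)
include hw

theorem isMark_tape_pos {i : Bool} {d : ℕ} (hd : d ≤ m + 1) :
    isMark (tape w (pos m i d)) = decide (d = 0) := by
  rcases Nat.eq_zero_or_pos d with rfl | hd0
  · cases i <;> simp [pos, hw.mark, isMark]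
  · rcases hd.eq_or_lt with rfl | hd
    · cases i
      · simp [pos, tape, isMark]
      · rw [tape_eq_rightEnd (by simp [pos, hw.length_eq]; omega)]
        simp [isMark]
    · obtain ⟨b, hb⟩ := hw.bit (pos m i d) (by cases i <;> simp [pos] <;> omega)
        (by cases i <;> simp [pos] <;> omega) (by cases i <;> simp [pos] <;> omega)
      rw [hb]
      simp [isMark, hd0.ne']

theorem isEnd_tape_pos {i : Bool} {d : ℕ} (hd : d ≤ m + 1) :
    isEnd (tape w (pos m i d)) = decide (d = m + 1) := by
  rcases Nat.eq_zero_or_pos d with rfl | hd0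
  · cases i <;> simp [pos, hw.mark, isEnd]
  · rcases hd.eq_or_lt with rfl | hd
    · cases i
      · simp [pos, tape, isEnd]
      · rw [tape_eq_rightEnd (by simp [pos, hw.length_eq]; omega)]
        simp [isEnd]
    · obtain ⟨b, hb⟩ := hw.bit (pos m i d) (by cases i <;> simp [pos] <;> omega)
        (by cases i <;> simp [pos] <;> omega) (by cases i <;> simp [pos] <;> omega)
      rw [hb]
      simp [isEnd, hd.ne]

theorem bitAt_end {i : Bool} : bitAt w m i (m + 1) = false := by
  cases i
  · simp [bitAt, pos, tape, bitOf]
  · rw [bitAt, tape_eq_rightEnd (by simp [pos, hw.length_eq]; omega)]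
    rfl

theorem step_stay {q q' : PalindromeState} {i : Bool} {d a b a' b' : ℕ} {da db : SignType}
    (hd : d ≤ m + 1)
    (hn : next q (tape w (pos m i d)) (decide (a = 0)) (decide (b = 0)) = some (q', 0, da, db))
    (ha : (a' : ℤ) = a + da) (hb : (b' : ℤ) = b + db) :
    (palindromeMachine k).Within w 1 (config k q (pos m i d) a b)
      (config k q' (pos m i d) a' b') :=
  step hn (by simp) (by have := hw.length_eq; cases i <;> simp [pos] <;> omega) ha hb

theorem step_out {q q' : PalindromeState} {i : Bool} {d a b a' b' : ℕ} {da db : SignType}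
    (hd : d ≤ m)
    (hn : next q (tape w (pos m i d)) (decide (a = 0)) (decide (b = 0)) =
      some (q', outward i, da, db))
    (ha : (a' : ℤ) = a + da) (hb : (b' : ℤ) = b + db) :
    (palindromeMachine k).Within w 1 (config k q (pos m i d) a b)
      (config k q' (pos m i (d + 1)) a' b') :=
  step hn (by cases i <;> simp [pos, outward] <;> omega)
    (by have := hw.length_eq; cases i <;> simp [pos] <;> omega) ha hb

theorem step_in {q q' : PalindromeState} {i : Bool} {d a b a' b' : ℕ} {da db : SignType}
    (hd : d ≤ m)
    (hn : next q (tape w (pos m i (d + 1))) (decide (a = 0)) (decide (b = 0)) =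
      some (q', -outward i, da, db))
    (ha : (a' : ℤ) = a + da) (hb : (b' : ℤ) = b + db) :
    (palindromeMachine k).Within w 1 (config k q (pos m i (d + 1)) a b)
      (config k q' (pos m i d) a' b') :=
  step hn (by cases i <;> simp [pos, outward] <;> omega)
    (by have := hw.length_eq; cases i <;> simp [pos] <;> omega) ha hb

/-- `B` counts the steps towards the mark, so that the walk can be undone later. -/
theorem compare_loop {i f e : Bool} {d a : ℕ} (he : e = true → 0 < a) (j b : ℕ)
    (hd : d + j ≤ m + 1) :
    (palindromeMachine k).Within w j
      (config k (compare i f e) (pos m i (d + j)) (a + if e then 0 else j) b)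
      (config k (compare i f e) (pos m i d) a (b + j)) := by
  induction j generalizing b with
  | zero => simpa using Within.refl _
  | succ j ih =>
    have h0 : (a + if e then 0 else j + 1) ≠ 0 := by
      cases e
      · simp
      · have := he rfl
        simp only [if_true]
        omega
    have h1 : (palindromeMachine k).Within w 1
        (config k (compare i f e) (pos m i (d + (j + 1))) (a + if e then 0 else j + 1) b)
        (config k (compare i f e) (pos m i (d + j)) (a + if e then 0 else j) (b + 1)) := by
      rw [← add_assoc d]
      refine hw.step_in (da := if e then 0 else -1) (db := 1) (by omega) ?_ ?_ (by simp)
      · simp only [h0, decide_false, next]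
        rw [hw.isMark_tape_pos (by omega)]
        simp
      · cases e
        · simp only [Bool.false_eq_true, if_false]
          push_cast
          simp [add_assoc]
        · simp
    have h2 := h1.trans (ih (b + 1) (by omega))
    rwa [add_comm 1 j, add_assoc, add_comm 1 j] at h2

/-- The way back of the comparison is used for doubling: each position regained puts two units into
`A`. -/
theorem double_loop {i f : Bool} (j d a : ℕ) (hd : d + j ≤ m + 1) :
    (palindromeMachine k).Within w (2 * j) (config k (double i f) (pos m i d) a j)
      (config k (double i f) (pos m i (d + j)) (a + 2 * j) 0) := by
  induction j generalizing d a with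
  | zero => exact Within.refl _
  | succ j ih =>
    have h1 : (palindromeMachine k).Within w 1 (config k (double i f) (pos m i d) a (j + 1))
        (config k (doubleMore i f) (pos m i (d + 1)) (a + 1) j) :=
      hw.step_out (da := 1) (db := -1) (by omega) (by simp [next]) (by simp) (by simp)
    have h2 : (palindromeMachine k).Within w 1
        (config k (doubleMore i f) (pos m i (d + 1)) (a + 1) j)
        (config k (double i f) (pos m i (d + 1)) (a + 2) j) :=
      hw.step_stay (da := 1) (db := 0) (by omega) (by simp [next])
        (by push_cast; simp; ring) (by simp)
    have h3 := (h1.trans h2).trans (ih (d + 1) (a + 2) (by omega))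
    rw [show d + 1 + j = d + (j + 1) by omega, show a + 2 + 2 * j = a + 2 * (j + 1) by omega] at h3
    exact h3.mono (by omega)

/-- This reverses the effect of `compare_loop` on the counters, possibly on the other side of the
mark. -/
theorem back_loop {i f e : Bool} (j d a : ℕ) (hd : d + j ≤ m + 1) :
    (palindromeMachine k).Within w j (config k (back i f e) (pos m i d) a j)
      (config k (back i f e) (pos m i (d + j)) (a + if e then 0 else j) 0) := by
  induction j generalizing d a with
  | zero => simpa using Within.refl _
  | succ j ih =>
    have h1 : (palindromeMachine k).Within w 1 (config k (back i f e) (pos m i d) a (j + 1))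
        (config k (back i f e) (pos m i (d + 1)) (a + if e then 0 else 1) j) :=
      hw.step_out (da := if e then 0 else 1) (db := -1) (by omega) (by simp [next])
        (by cases e <;> simp) (by simp)
    have h2 := h1.trans (ih (d + 1) (a + if e then 0 else 1) (by omega))
    rw [show d + 1 + j = d + (j + 1) by omega,
      show (a + if e then 0 else 1) + (if e then 0 else j) = a + if e then 0 else j + 1 by
        cases e <;> simp; omega] at h2
    exact h2.mono (by omega)

theorem restore_loop {i e : Bool} {d : ℕ} (hd : d ≤ m + 1) (j a : ℕ) :
    (palindromeMachine k).Within w j (config k (restore i e) (pos m i d) a j)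
      (config k (restore i e) (pos m i d) (a + j) 0) := by
  induction j generalizing a with
  | zero => exact Within.refl _
  | succ j ih =>
    have h1 : (palindromeMachine k).Within w 1 (config k (restore i e) (pos m i d) a (j + 1))
        (config k (restore i e) (pos m i d) (a + 1) j) :=
      hw.step_stay (da := 1) (db := -1) hd (by simp [next]) (by simp) (by simp)
    have h2 := h1.trans (ih (a + 1))
    rw [show a + 1 + j = a + (j + 1) by omega] at h2
    exact h2.mono (by omega)

theorem drain_loop {i : Bool} {d : ℕ} (hd : d ≤ m + 1) (a : ℕ) :
    (palindromeMachine k).Within w a (config k (drain i) (pos m i d) a 0)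
      (config k (drain i) (pos m i d) 0 0) := by
  induction a with
  | zero => exact Within.refl _
  | succ a ih =>
    have h1 : (palindromeMachine k).Within w 1 (config k (drain i) (pos m i d) (a + 1) 0)
        (config k (drain i) (pos m i d) a 0) :=
      hw.step_stay (da := -1) (db := 0) hd (by simp [next]) (by simp) (by simp)
    exact (h1.trans ih).mono (by omega)

theorem halve_loop {i e : Bool} {d : ℕ} (hd : d ≤ m + 1) (r u b : ℕ) :
    (palindromeMachine k).Within w (2 * u) (config k (halve i e) (pos m i d) (2 * u + r) b)
      (config k (halve i e) (pos m i d) r (b + u)) := by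
  induction u generalizing b with
  | zero => simpa using Within.refl _
  | succ u ih =>
    have h1 : (palindromeMachine k).Within w 1
        (config k (halve i e) (pos m i d) (2 * (u + 1) + r) b)
        (config k (halveMore i e) (pos m i d) (2 * u + r + 1) b) :=
      hw.step_stay (da := -1) (db := 0) hd (by simp [next]) (by push_cast; simp; ring) (by simp)
    have h2 : (palindromeMachine k).Within w 1
        (config k (halveMore i e) (pos m i d) (2 * u + r + 1) b)
        (config k (halve i e) (pos m i d) (2 * u + r) (b + 1)) :=
      hw.step_stay (da := -1) (db := 1) hd (by simp [next]) (by push_cast; simp) (by simp)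
    have h3 := (h1.trans h2).trans (ih (b + 1))
    rw [show b + 1 + u = b + (u + 1) by omega] at h3
    exact h3.mono (by omega)

/-- A letter is read, and the block goes on. -/
theorem read_continue {i f : Bool} {d v : ℕ} (hdm : d ≤ m)
    (hv : 2 * v + (bitAt w m i d).toNat ≤ d) :
    (palindromeMachine k).Within w (3 * (2 * v + (bitAt w m i d).toNat) + 3)
      (config k (read i f) (pos m i d) (2 * v) 0)
      (config k (read i f) (pos m i (d + 1)) (2 * (2 * v + (bitAt w m i d).toNat)) 0) := by
  set r := (bitAt w m i d).toNat with hr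
  -- `d'` is the distance at which `A` runs out on the way to the mark.
  obtain ⟨d', hd'⟩ := Nat.exists_eq_add_of_le' hv
  have h1 : (palindromeMachine k).Within w 1 (config k (read i f) (pos m i d) (2 * v) 0)
      (config k (compare i f false) (pos m i d) (2 * v + r) 0) := by
    refine hw.step_stay (da := if bitAt w m i d then 1 else 0) (db := 0) (by omega) ?_ ?_ (by simp)
    · simp [next, hw.isEnd_tape_pos (i := i) (show d ≤ m + 1 by omega), bitAt,
        show d ≠ m + 1 by omega]
      rfl
    · rw [hr]
      cases bitAt w m i d <;> simp
  have h2 := hw.compare_loop (k := k) (i := i) (f := f) (e := false) (d := d') (a := 0) (by simp)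
    (2 * v + r) 0 (by omega)
  simp only [Bool.false_eq_true, if_false, zero_add, ← hd'] at h2
  have h3 : (palindromeMachine k).Within w 1
      (config k (compare i f false) (pos m i d') 0 (2 * v + r))
      (config k (double i f) (pos m i d') 0 (2 * v + r)) :=
    hw.step_stay (da := 0) (db := 0) (by omega) (by simp [next]) (by simp) (by simp)
  have h4 := hw.double_loop (k := k) (i := i) (f := f) (2 * v + r) d' 0 (by omega)
  rw [← hd', zero_add] at h4
  have h5 : (palindromeMachine k).Within w 1
      (config k (double i f) (pos m i d) (2 * (2 * v + r)) 0)
      (config k (read i f) (pos m i (d + 1)) (2 * (2 * v + r)) 0) :=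
    hw.step_out (da := 0) (db := 0) hdm (by simp [next]) (by simp) (by simp)
  exact ((((h1.trans h2).trans h3).trans h4).trans h5).mono (by omega)

/-- A letter is read, and the block ends; the head goes to the mark and away from it. -/
theorem read_stop {i f : Bool} {d v : ℕ} (hdm : d ≤ m + 1) (hv0 : 1 ≤ v)
    (hv : d = m + 1 ∨ d < 2 * v + (bitAt w m i d).toNat) :
    (palindromeMachine k).Within w (2 * d + 3)
      (config k (read i f) (pos m i d) (2 * v) 0)
      (config k (if f then drain i else halve (!i) (decide (d = m + 1)))
        (pos m (if f then i else !i) d) (2 * v + (bitAt w m i d).toNat) 0) := by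
  set v' := 2 * v + (bitAt w m i d).toNat with hv'
  set e := decide (d = m + 1) with he
  set i' := if f then i else !i with hi'
  -- `a` is the content of `A` on arrival at the mark; being positive, it shows the machine that the
  -- block ends.
  obtain ⟨a, ha, ha0⟩ : ∃ a, v' = a + (if e then 0 else d) ∧ 0 < a := by
    by_cases h : d = m + 1
    · exact ⟨v', by simp [he, h], by omega⟩
    · exact ⟨v' - d, by simp [he, h]; omega, by omega⟩
  have h1 : (palindromeMachine k).Within w 1 (config k (read i f) (pos m i d) (2 * v) 0)
      (config k (compare i f e) (pos m i d) v' 0) := by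
    refine hw.step_stay (da := if bitAt w m i d then 1 else 0) (db := 0) hdm ?_ ?_ (by simp)
    · simp [next, hw.isEnd_tape_pos (i := i) hdm, bitAt, he]
      rfl
    · rw [hv']
      cases bitAt w m i d <;> simp
  have h2 := hw.compare_loop (k := k) (i := i) (f := f) (e := e) (d := 0) (a := a) (fun _ => ha0)
    d 0 (by omega)
  simp only [zero_add, ← ha] at h2
  -- At distance 0 the sides coincide, so the head can change sides without moving.
  have hp : pos m i 0 = pos m i' 0 := by cases i <;> cases i' <;> rfl
  have h3 : (palindromeMachine k).Within w 1
      (config k (compare i f e) (pos m i 0) a d) (config k (back i' f e) (pos m i' 0) a d) := by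
    rw [← hp]
    refine hw.step_stay (da := 0) (db := 0) (by omega) ?_ (by simp) (by simp)
    simp [next, ha0.ne', hw.isMark_tape_pos (i := i) (Nat.zero_le (m + 1)), hi']
  have h4 := hw.back_loop (k := k) (i := i') (f := f) (e := e) d 0 a (by omega)
  rw [zero_add, ← ha] at h4
  have h5 : (palindromeMachine k).Within w 1
      (config k (back i' f e) (pos m i' d) v' 0)
      (config k (if f then drain i else halve (!i) e) (pos m i' d) v' 0) := by
    refine hw.step_stay (da := 0) (db := 0) hdm ?_ (by simp) (by simp)
    simp only [next, hi']
    cases f <;> simp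
  exact ((((h1.trans h2).trans h3).trans h4).trans h5).mono (by omega)

/-- A letter is compared with the last digit of the code. -/
theorem halve_step {i e : Bool} {d u : ℕ} {r : Bool} (hd : d ≤ m) (hu : 1 ≤ u) :
    (bitAt w m i (d + 1) = r → (palindromeMachine k).Within w (3 * u + 3)
      (config k (halve i e) (pos m i (d + 1)) (2 * u + r.toNat) 0)
      (config k (halve i e) (pos m i d) u 0)) ∧
    (bitAt w m i (d + 1) ≠ r → ∀ P, ¬ P → (palindromeMachine k).Decides w (3 * u + 3)
      (config k (halve i e) (pos m i (d + 1)) (2 * u + r.toNat) 0) P) := by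
  -- A nonzero `B` distinguishes a digit 1 from the leading 1.
  have hu0 : u ≠ 0 := by omega
  have h1 := hw.halve_loop (k := k) (i := i) (e := e) (d := d + 1) (by omega) r.toNat u 0
  rw [zero_add] at h1
  have h3 := hw.restore_loop (k := k) (i := i) (e := e) (d := d) (by omega) u 0
  rw [zero_add] at h3
  have h4 : (palindromeMachine k).Within w 1 (config k (restore i e) (pos m i d) u 0)
      (config k (halve i e) (pos m i d) u 0) :=
    hw.step_stay (da := 0) (db := 0) (by omega) (by simp [next]) (by simp) (by simp)
  rw [bitAt]
  cases r
  · refine ⟨fun hb => ?_, fun hb P hP => ?_⟩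
    · have h2 : (palindromeMachine k).Within w 1 (config k (halve i e) (pos m i (d + 1)) 0 u)
          (config k (restore i e) (pos m i d) 0 u) :=
        hw.step_in (da := 0) (db := 0) hd (by simp [next, hb]) (by simp) (by simp)
      exact (((h1.trans h2).trans h3).trans h4).mono (by omega)
    · refine (h1.decides (decides_of_next_eq_none (N := 0) ?_ (by simp [hP]))).mono (by omega)
      simp [next, hb]
  · have h2 : (palindromeMachine k).Within w 1 (config k (halve i e) (pos m i (d + 1)) 1 u)
        (config k (halveMore i e) (pos m i (d + 1)) 0 u) :=
      hw.step_stay (da := -1) (db := 0) (by omega) (by simp [next]) (by simp) (by simp)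
    refine ⟨fun hb => ?_, fun hb P hP => ?_⟩
    · have h2' : (palindromeMachine k).Within w 1 (config k (halveMore i e) (pos m i (d + 1)) 0 u)
          (config k (restore i e) (pos m i d) 0 u) :=
        hw.step_in (da := 0) (db := 0) hd (by simp [next, hb, hu0]) (by simp) (by simp)
      exact ((((h1.trans h2).trans h2').trans h3).trans h4).mono (by omega)
    · refine ((h1.trans h2).decides
        (decides_of_next_eq_none (N := 0) ?_ (by simp [hP]))).mono (by omega)
      simp [next, hb, hu0]

theorem halve_end {i e : Bool} {d : ℕ} (hd : d ≤ m + 1) :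
    (palindromeMachine k).Within w 2 (config k (halve i e) (pos m i d) 1 0)
      (config k (if e then accept else first i true) (pos m i d) 0 0) := by
  have h1 : (palindromeMachine k).Within w 1 (config k (halve i e) (pos m i d) 1 0)
      (config k (halveMore i e) (pos m i d) 0 0) :=
    hw.step_stay (da := -1) (db := 0) hd (by simp [next]) (by simp) (by simp)
  have h2 : (palindromeMachine k).Within w 1 (config k (halveMore i e) (pos m i d) 0 0)
      (config k (if e then accept else first i true) (pos m i d) 0 0) :=
    hw.step_stay (da := 0) (db := 0) hd (by simp [next]) (by simp) (by simp)
  exact h1.trans h2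

end Centered

end palindromeMachine

/-! ### Blocks: cost and number. -/

namespace palindromeMachine

/-- The number with the binary digits `1, g (D + 1), …, g (D + n)`. -/
def code (g : ℕ → Bool) (D : ℕ) : ℕ → ℕ
  | 0 => 1
  | n + 1 => 2 * code g D n + (g (D + n + 1)).toNat

theorem one_le_code (g : ℕ → Bool) (D n : ℕ) : 1 ≤ code g D n := by
  induction n with
  | zero => rfl
  | succ n ih => simp only [code]; omega

/-- A block whose code exceeds the distance reached must therefore have at least logarithmic length.
-/
theorem code_lt (g : ℕ → Bool) (D n : ℕ) : code g D n < 2 ^ (n + 1) := by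
  induction n with
  | zero => simp [code]
  | succ n ih =>
    have := (g (D + n + 1)).toNat_le
    simp only [code]
    omega

theorem code_congr {g g' : ℕ → Bool} {D n : ℕ}
    (h : ∀ j, 1 ≤ j → j ≤ n → g (D + j) = g' (D + j)) : code g D n = code g' D n := by
  induction n with
  | zero => rfl
  | succ n ih =>
    simp only [code]
    rw [ih fun j h1 h2 => h j h1 (by omega), add_assoc, h (n + 1) (by omega) le_rfl]

/-- The letters on both sides agree up to the distance `D`. -/
def Agree (w : List MarkedLetter) (m D : ℕ) : Prop :=
  ∀ d, 1 ≤ d → d ≤ D → bitAt w m true d = bitAt w m false d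

variable {k : ℕ} {w : List MarkedLetter} {m : ℕ}

theorem Agree.apply {D d : ℕ} (h : Agree w m D) (i : Bool) (h1 : 1 ≤ d) (h2 : d ≤ D) :
    bitAt w m i d = bitAt w m (!i) d := by
  cases i
  · exact (h d h1 h2).symm
  · exact h d h1 h2

theorem Agree.add {D n : ℕ} (h : Agree w m D) {i : Bool}
    (h' : ∀ j, 1 ≤ j → j ≤ n → bitAt w m (!i) (D + j) = bitAt w m i (D + j)) :
    Agree w m (D + n) := by
  intro d h1 h2
  by_cases hd : d ≤ D
  · exact h d h1 hd
  · obtain ⟨j, rfl⟩ := Nat.exists_eq_add_of_le (not_le.1 hd).le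
    have := h' j (by omega) (by omega)
    cases i
    · exact this
    · exact this.symm

namespace Centered

variable (hw : Centered w m)
include hw

/-- A letter costs time linear in the current code, which at least doubles each time, so the sum is
geometric. Hypothesis `hc` says that the block does not stop early. -/
theorem read_block {i f : Bool} {D : ℕ} (n : ℕ) (hn : D + n ≤ m)
    (hc : ∀ j, 1 ≤ j → j ≤ n → code (bitAt w m i) D j ≤ D + j) :
    (palindromeMachine k).Within w (12 * code (bitAt w m i) D n)
      (config k (first i f) (pos m i D) 0 0)
      (config k (read i f) (pos m i (D + n + 1)) (2 * code (bitAt w m i) D n) 0) := by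
  induction n with
  | zero =>
    have h1 : (palindromeMachine k).Within w 1 (config k (first i f) (pos m i D) 0 0)
        (config k (second i f) (pos m i D) 1 0) :=
      hw.step_stay (da := 1) (db := 0) (by omega) (by simp [next]) (by simp) (by simp)
    have h2 : (palindromeMachine k).Within w 1 (config k (second i f) (pos m i D) 1 0)
        (config k (read i f) (pos m i (D + 1)) 2 0) :=
      hw.step_out (da := 1) (db := 0) (by omega) (by simp [next]) (by simp) (by simp)
    exact (h1.trans h2).mono (by simp [code])
  | succ n ih =>
    have h1 := ih (by omega) fun j h1 h2 => hc j h1 (by omega)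
    have h2 := hw.read_continue (k := k) (i := i) (f := f) (d := D + n + 1)
      (v := code (bitAt w m i) D n) (by omega) (hc (n + 1) (by omega) le_rfl)
    have h3 := one_le_code (bitAt w m i) D n
    refine (h1.trans h2).mono ?_
    simp only [code]
    omega

/-- Halving yields the digits from the last one on, which fits a head moving towards the mark. The
costs again form a geometric sum. -/
theorem check_block {i e : Bool} {D : ℕ} (g : ℕ → Bool) (n : ℕ) (hn : D + n ≤ m + 1) :
    ((∀ j, 1 ≤ j → j ≤ n → bitAt w m i (D + j) = g (D + j)) →
      (palindromeMachine k).Within w (6 * code g D n)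
        (config k (halve i e) (pos m i (D + n)) (code g D n) 0)
        (config k (halve i e) (pos m i D) 1 0)) ∧
    ((¬ ∀ j, 1 ≤ j → j ≤ n → bitAt w m i (D + j) = g (D + j)) → ∀ P, ¬ P →
      (palindromeMachine k).Decides w (6 * code g D n)
        (config k (halve i e) (pos m i (D + n)) (code g D n) 0) P) := by
  induction n with
  | zero => exact ⟨fun _ => .refl _, fun h => absurd (fun j h1 h2 => by omega) h⟩
  | succ n ih =>
    have h1 := one_le_code g D n
    have h2 := hw.halve_step (k := k) (i := i) (e := e) (d := D + n) (r := g (D + n + 1))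
      (by omega) h1
    have ih := ih (by omega)
    have hb : 3 * code g D n + 3 + 6 * code g D n ≤ 6 * code g D (n + 1) := by
      simp only [code]
      omega
    refine ⟨fun h => ((h2.1 (h (n + 1) (by omega) le_rfl)).trans
      (ih.1 fun j h3 h4 => h j h3 (by omega))).mono hb, fun h P hP => ?_⟩
    by_cases h3 : bitAt w m i (D + n + 1) = g (D + n + 1)
    · refine ((h2.1 h3).decides (ih.2 (fun h4 => h fun j h5 h6 => ?_) P hP)).mono hb
      rcases h6.eq_or_lt with rfl | h6
      · exact h3
      · exact h4 j h5 (by omega)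
    · exact (h2.2 h3 P hP).mono (by omega)

/-- Either the next block is the last one or does not fit, or the machine goes on behind it. -/
theorem decides_or_next_block {i : Bool} {D : ℕ} (hD : D ≤ m) (hA : Agree w m D) :
    (palindromeMachine k).Decides w (60 * (m + 1))
      (config k (first i false) (pos m i D) 0 0) (Agree w m m) ∨
    ∃ n, 1 ≤ n ∧ D + n ≤ m ∧ D + n < 2 ^ (n + 1) ∧ Agree w m (D + n) ∧
      (palindromeMachine k).Within w (60 * (m + 1))
        (config k (first i false) (pos m i D) 0 0)
        (config k (first (!i) false) (pos m (!i) (D + n)) 0 0) := by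
  classical
  set g := bitAt w m i with hg
  -- The block consists of `n + 1` letters, where an end-marker at distance `m + 1` counts as a
  -- letter `false`.
  have hex : ∃ n, D + n + 1 = m + 1 ∨ D + n + 1 < code g D (n + 1) := ⟨m - D, .inl (by omega)⟩
  obtain ⟨n, hn, hmin⟩ : ∃ n, (D + n + 1 = m + 1 ∨ D + n + 1 < code g D (n + 1)) ∧
      ∀ j < n, ¬ (D + j + 1 = m + 1 ∨ D + j + 1 < code g D (j + 1)) :=
    ⟨Nat.find hex, Nat.find_spec hex, fun j => Nat.find_min hex⟩
  have hnm : D + n ≤ m := by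
    by_contra! h
    exact hmin (m - D) (by omega) (.inl (by omega))
  have hc : ∀ j, 1 ≤ j → j ≤ n → code g D j ≤ D + j := by
    intro j h1 h2
    have := hmin (j - 1) (by omega)
    rw [add_assoc, Nat.sub_add_cancel h1] at this
    omega
  have hcn : code g D n ≤ m + 1 := by
    rcases Nat.eq_zero_or_pos n with rfl | h0
    · simp [code]
    · have := hc n h0 le_rfl
      omega
  have hcn' : code g D (n + 1) ≤ 2 * m + 3 := by
    have := (g (D + n + 1)).toNat_le
    simp only [code]
    omega
  have h1 := (hw.read_block (k := k) (i := i) (f := false) n hnm hc).trans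
    (hw.read_stop (k := k) (i := i) (f := false) (d := D + n + 1) (by omega)
      (one_le_code _ _ _) hn)
  simp only [Bool.false_eq_true, if_false, ← hg] at h1
  change (palindromeMachine k).Within w _ _ (config k _ _ (code g D (n + 1)) 0) at h1
  set e := decide (D + n + 1 = m + 1) with he
  have h2 := hw.check_block (k := k) (i := !i) (e := e) (D := D) g (n + 1) (by omega)
  by_cases hag : ∀ j, 1 ≤ j → j ≤ n + 1 → bitAt w m (!i) (D + j) = g (D + j)
  · have hA' : Agree w m (D + (n + 1)) := hA.add hag
    have h3 := (h1.trans (h2.1 hag)).trans (hw.halve_end (k := k) (i := !i) (e := e) (by omega))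
    by_cases hlast : D + n + 1 = m + 1
    · left
      simp only [he, hlast, decide_true, if_true] at h3
      refine (h3.decides (decides_of_next_eq_none (N := 0) (by simp [next]) ?_)).mono (by omega)
      exact iff_of_true rfl fun d h4 h5 => hA' d h4 (by omega)
    · right
      simp only [he, hlast, decide_false, Bool.false_eq_true, if_false] at h3
      -- Checking has used up the code and brought the head back to distance `D`. As both sides
      -- agree on the block, reading it again on this side stops at the same distance.
      have hcc : ∀ j ≤ n + 1, code (bitAt w m (!i)) D j = code g D j := fun j hj =>
        code_congr fun j' h4 h5 => hag j' h4 (by omega)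
      have h4 := (hw.read_block (k := k) (i := !i) (f := true) (D := D) n hnm
        (fun j h4 h5 => (hcc j (by omega)).trans_le (hc j h4 h5))).trans
        (hw.read_stop (k := k) (i := !i) (f := true) (d := D + n + 1) (by omega)
          (one_le_code _ _ _) (.inr ((hn.resolve_left hlast).trans_eq (hcc (n + 1) le_rfl).symm)))
      simp only [if_true] at h4
      change (palindromeMachine k).Within w _ _
        (config k _ _ (code (bitAt w m (!i)) D (n + 1)) 0) at h4
      rw [hcc _ le_rfl, hcc n (by omega)] at h4
      have h5 := hw.drain_loop (k := k) (i := !i) (d := D + n + 1) (by omega) (code g D (n + 1))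
      have h6 : (palindromeMachine k).Within w 1
          (config k (drain (!i)) (pos m (!i) (D + n + 1)) 0 0)
          (config k (first (!i) false) (pos m (!i) (D + n + 1)) 0 0) :=
        hw.step_stay (da := 0) (db := 0) (by omega) (by simp [next]) (by simp) (by simp)
      exact ⟨n + 1, by omega, by omega, (hn.resolve_left hlast).trans (code_lt _ _ _), hA',
        (((h3.trans h4).trans h5).trans h6).mono (by omega)⟩
  · left
    refine (h1.decides (h2.2 hag _ fun hA' => hag fun j h3 h4 => ?_)).mono (by omega)
    -- A mismatch must occur at a real letter, since the two end-markers always agree.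
    by_cases h5 : D + j ≤ m
    · exact (hA'.apply i (by omega) h5).symm
    · obtain h6 : D + j = m + 1 := by omega
      rw [hg, h6, hw.bitAt_end, hw.bitAt_end]

/-- There are `O(n / log n)` blocks. -/
theorem decides_agree {l : ℕ} (hl : 1 ≤ l) {i : Bool} {D : ℕ} (hD : D ≤ m) (hA : Agree w m D) :
    (palindromeMachine k).Decides w (60 * (m + 1) * (2 ^ l - D + (m - D) / l + 1))
      (config k (first i false) (pos m i D) 0 0) (Agree w m m) := by
  induction hr : m - D using Nat.strong_induction_on generalizing i D with
  | _ r ih =>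
    rcases hw.decides_or_next_block (k := k) (i := i) hD hA with h | ⟨n, h1, h2, h3, h4, h5⟩
    · exact h.mono (Nat.le_mul_of_pos_right _ (Nat.succ_pos _))
    · refine (h5.decides (ih (m - (D + n)) (by omega) h2 h4 rfl)).mono ?_
      rw [add_comm, ← Nat.mul_succ]
      refine Nat.mul_le_mul_left _ (Nat.succ_le_succ ?_)
      -- Below `2 ^ l` every block lowers `2 ^ l - D`. From there on, `D + n < 2 ^ (n + 1)` gives `l
      -- ≤ n`, so the quotient drops.
      by_cases hlD : D < 2 ^ l
      · have : (m - (D + n)) / l ≤ r / l := Nat.div_le_div_right (by omega)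
        omega
      · have h6 : l < n + 1 := (Nat.pow_lt_pow_iff_right (a := 2) (by norm_num)).1 (by omega)
        have h7 : (m - (D + n)) / l + 1 ≤ r / l := by
          rw [← Nat.add_div_right _ (by omega)]
          exact Nat.div_le_div_right (by omega)
        omega

end Centered

end palindromeMachine

/-! ### Arbitrary inputs: checking that the mark is in the middle. -/

open MarkedLetter (bit mark)

/-- A word consists of bits only, or it has a first mark. -/
theorem eq_bits_or_exists_mark (w : List MarkedLetter) :
    (∃ x : List Bool, w = x.map bit) ∨ ∃ (x : List Bool) (r : List MarkedLetter),
      w = x.map bit ++ mark :: r := by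
  induction w with
  | nil => exact .inl ⟨[], rfl⟩
  | cons a w ih =>
    cases a with
    | mark => exact .inr ⟨[], w, rfl⟩
    | bit b =>
      rcases ih with ⟨x, rfl⟩ | ⟨x, r, rfl⟩
      · exact .inl ⟨b :: x, rfl⟩
      · exact .inr ⟨b :: x, r, rfl⟩

theorem bits_append_mark_inj {x z : List Bool} {r s : List MarkedLetter}
    (h : x.map bit ++ mark :: r = z.map bit ++ mark :: s) : x = z ∧ r = s := by
  induction x generalizing z with
  | nil =>
    cases z with
    | nil => simpa using h
    | cons b z => simp at h
  | cons a x ih =>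
    cases z with
    | nil => simp at h
    | cons b z =>
      simp only [List.map_cons, List.cons_append, List.cons.injEq, MarkedLetter.bit.injEq] at h
      obtain ⟨rfl, rfl⟩ := ih h.2
      exact ⟨by rw [h.1], rfl⟩

theorem bits_append_mark_mem_iff {x : List Bool} {r : List MarkedLetter} :
    x.map bit ++ mark :: r ∈ markedPalindromes ↔ r = x.reverse.map bit := by
  refine ⟨fun ⟨z, hz⟩ => ?_, fun h => ⟨x, by rw [h]⟩⟩
  obtain ⟨rfl, h⟩ := bits_append_mark_inj hz
  exact h

theorem bits_not_mem (x : List Bool) : x.map bit ∉ markedPalindromes := by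
  rintro ⟨z, hz⟩
  have : mark ∈ x.map bit := by rw [hz]; simp
  simp at this

namespace palindromeMachine

variable {k : ℕ}

theorem tape_append_cons (u : List MarkedLetter) (a : MarkedLetter) (v : List MarkedLetter) :
    tape (u ++ a :: v) (u.length + 1) = .letter a := by
  simp [tape]

theorem countUp_run (x : List Bool) (u v : List MarkedLetter) (a : ℕ) :
    (palindromeMachine k).Within (u ++ (x.map bit ++ v)) x.length
      (config k countUp (u.length + 1) a 0)
      (config k countUp (u.length + x.length + 1) (a + x.length) 0) := by
  induction x generalizing u a with
  | nil => exact .refl _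
  | cons b x ih =>
    have h1 : (palindromeMachine k).Within (u ++ ((b :: x).map bit ++ v)) 1
        (config k countUp (u.length + 1) a 0) (config k countUp (u.length + 1 + 1) (a + 1) 0) := by
      refine step (d := 1) (da := 1) (db := 0) ?_ (by simp) (by simp) (by simp) (by simp)
      rw [List.map_cons, List.cons_append, tape_append_cons]
      rfl
    have h2 := ih (u ++ [.bit b]) (a + 1)
    simp only [List.append_assoc, List.singleton_append, List.length_append,
      List.length_singleton] at h2
    rw [show u.length + 1 + x.length + 1 = u.length + (b :: x).length + 1 by simp; omega,
      show a + 1 + x.length = a + (b :: x).length by simp; omega] at h2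
    exact (h1.trans h2).mono (by simp [add_comm])

theorem countDown_run (x : List Bool) (u v : List MarkedLetter) (a : ℕ) :
    (palindromeMachine k).Within (u ++ (x.map bit ++ v)) x.length
      (config k countDown (u.length + 1) (a + x.length) 0)
      (config k countDown (u.length + x.length + 1) a 0) := by
  induction x generalizing u with
  | nil => exact .refl _
  | cons b x ih =>
    have h1 : (palindromeMachine k).Within (u ++ ((b :: x).map bit ++ v)) 1
        (config k countDown (u.length + 1) (a + (b :: x).length) 0)
        (config k countDown (u.length + 1 + 1) (a + x.length) 0) := by
      refine step (d := 1) (da := -1) (db := 0) ?_ (by simp) (by simp) (by simp; ring) (by simp)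
      rw [List.map_cons, List.cons_append, tape_append_cons]
      simp [next]
    have h2 := ih (u ++ [.bit b])
    simp only [List.append_assoc, List.singleton_append, List.length_append,
      List.length_singleton] at h2
    rw [show u.length + 1 + x.length + 1 = u.length + (b :: x).length + 1 by simp; omega] at h2
    exact (h1.trans h2).mono (by simp [add_comm])

variable {x y : List Bool}

theorem tape_bits_left (r : List MarkedLetter) {p : ℕ} (hp : p < x.length) :
    tape (x.map bit ++ mark :: r) (p + 1) = .letter (.bit x[p]) := by
  simp [tape, List.getElem?_append_left, hp]

theorem tape_bits_right {p : ℕ} (hp : p < y.length) :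
    tape (x.map bit ++ mark :: y.map bit) (x.length + 1 + (p + 1)) = .letter (.bit y[p]) := by
  rw [← add_assoc]
  simp only [tape]
  rw [List.getElem?_append_right (by simp; omega)]
  simp [show x.length + 1 + p - x.length = p + 1 by omega, hp]

theorem centered_of_length_eq (h : y.length = x.length) :
    Centered (x.map bit ++ mark :: y.map bit) x.length where
  length_eq := by simp; omega
  mark := by
    have := tape_append_cons (x.map bit) .mark (y.map bit)
    rwa [List.length_map] at this
  bit p h1 h2 h3 := by
    obtain ⟨p, rfl⟩ := Nat.exists_eq_add_of_le' h1
    by_cases hp : p < x.length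
    · exact ⟨_, tape_bits_left _ hp⟩
    · obtain ⟨q, hq⟩ := Nat.exists_eq_add_of_le (show x.length + 1 + 1 ≤ p + 1 by omega)
      rw [hq, add_assoc, add_comm 1 q]
      exact ⟨_, tape_bits_right (by omega)⟩

theorem agree_iff (h : y.length = x.length) :
    Agree (x.map bit ++ mark :: y.map bit) x.length x.length ↔ y = x.reverse := by
  have hl {p : ℕ} (hp : p < x.length) :
      bitAt (x.map bit ++ mark :: y.map bit) x.length false (p + 1) =
        x[x.length - 1 - p] := by
    simp only [bitAt, pos, Bool.false_eq_true, if_false]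
    rw [show x.length + 1 - (p + 1) = x.length - 1 - p + 1 by omega, tape_bits_left _ (by omega)]
    rfl
  have hr {p : ℕ} (hp : p < y.length) :
      bitAt (x.map bit ++ mark :: y.map bit) x.length true (p + 1) = y[p] := by
    simp only [bitAt, pos, if_true]
    rw [tape_bits_right hp]
    rfl
  constructor
  · intro hA
    refine List.ext_getElem (by simp [h]) fun p h1 h2 => ?_
    have := hA (p + 1) (by omega) (by omega)
    rw [hl (by omega), hr h1] at this
    rw [this, List.getElem_reverse]
  · rintro rfl d h1 h2
    obtain ⟨p, rfl⟩ := Nat.exists_eq_add_of_le' h1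
    rw [hl (by omega), hr (by omega), List.getElem_reverse]

theorem Centered.seek_run {w : List MarkedLetter} {m : ℕ} (hw : Centered w m) (j : ℕ)
    (hj : j ≤ m) :
    (palindromeMachine k).Within w (j + 1) (config k seek (pos m true j) 0 0)
      (config k (first false false) (pos m false 0) 0 0) := by
  induction j with
  | zero =>
    refine hw.step_stay (i := false) (d := 0) (da := 0) (db := 0) (by omega) ?_ (by simp) (by simp)
    simp [pos, hw.mark, next]
  | succ j ih =>
    obtain ⟨b, hb⟩ := hw.bit (pos m true (j + 1)) (by simp [pos]; omega) (by simp [pos]; omega)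
      (by simp [pos])
    have h1 : (palindromeMachine k).Within w 1 (config k seek (pos m true (j + 1)) 0 0)
        (config k seek (pos m true j) 0 0) :=
      hw.step_in (da := 0) (db := 0) (by omega) (by rw [hb]; rfl) (by simp) (by simp)
    exact (h1.trans (ih (by omega))).mono (by omega)

/-- The machine decides marked palindromes. -/
theorem decides {l : ℕ} (hl : 1 ≤ l) (w : List MarkedLetter) :
    (palindromeMachine k).Decides w (60 * (w.length + 5) * (2 ^ l + w.length / l + 2))
      (palindromeMachine k).initial (w ∈ markedPalindromes) := by
  have hbound {N : ℕ} (h : N ≤ 2 * w.length + 5) :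
      N ≤ 60 * (w.length + 5) * (2 ^ l + w.length / l + 2) := by
    refine le_trans ?_ (Nat.le_mul_of_pos_right _ (Nat.succ_pos _))
    omega
  rw [initial_eq]
  rcases eq_bits_or_exists_mark w with ⟨x, rfl⟩ | ⟨x, r, rfl⟩
  · have h1 := countUp_run (k := k) x [] [] 0
    simp only [List.nil_append, List.append_nil, List.length_nil, zero_add] at h1
    refine (h1.decides (decides_of_next_eq_none (N := 0) ?_ ?_)).mono
      (hbound (by simp; omega))
    · rw [tape_eq_rightEnd (by simp)]
      rfl
    · exact iff_of_false (by simp) (bits_not_mem x)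
  have h1 := countUp_run (k := k) x [] (.mark :: r) 0
  simp only [List.nil_append, List.length_nil, zero_add] at h1
  have h2 : (palindromeMachine k).Within (x.map bit ++ mark :: r) 1
      (config k countUp (x.length + 1) x.length 0)
      (config k countDown (x.length + 1 + 1) x.length 0) := by
    refine step (d := 1) (da := 0) (db := 0) ?_ (by simp) (by simp) (by simp) (by simp)
    have := tape_append_cons (x.map bit) .mark r
    rw [List.length_map] at this
    rw [this]
    rfl
  have h12 := h1.trans h2
  rw [bits_append_mark_mem_iff]
  have hmap {y y' : List Bool} : y.map bit = y'.map bit ↔ y = y' :=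
    (List.map_injective_iff.2 bit_injective).eq_iff
  have hrun {y : List Bool} {v : List MarkedLetter} (hr : r = y.map bit ++ v)
      (hy : y.length ≤ x.length) :
      (palindromeMachine k).Within (x.map bit ++ mark :: r) y.length
        (config k countDown (x.length + 1 + 1) x.length 0)
        (config k countDown (x.length + 1 + y.length + 1) (x.length - y.length) 0) := by
    have := countDown_run (k := k) y (x.map bit ++ [.mark]) v (x.length - y.length)
    simpa [Nat.sub_add_cancel hy, hr] using this
  -- More than `x.length` bits follow the mark: the counter is empty while a bit is read, and the
  -- machine rejects. Otherwise the counter lasts until the next mark or the end (`hshort`).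
  by_cases hlong : ∃ (y : List Bool) (b : Bool) (v : List MarkedLetter),
      y.length = x.length ∧ r = y.map bit ++ .bit b :: v
  · obtain ⟨y, b, v, hy, hr⟩ := hlong
    refine ((h12.trans (hrun hr hy.le)).decides
      (decides_of_next_eq_none (N := 0) ?_ ?_)).mono (hbound (by simp; omega))
    · have := tape_append_cons (x.map bit ++ mark :: y.map bit) (.bit b) v
      rw [hr, show x.length + 1 + y.length + 1 =
        (x.map bit ++ mark :: y.map bit).length + 1 by simp; omega]
      simp only [List.append_assoc, List.cons_append] at this
      rw [this]
      simp [hy, next]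
    · refine iff_of_false (by simp) fun h => ?_
      have h3 := congrArg List.length (hr.symm.trans h)
      simp at h3
      omega
  have hshort {y : List Bool} {v : List MarkedLetter} (hr : r = y.map bit ++ v) :
      y.length ≤ x.length := by
    by_contra! hlt
    refine hlong ⟨y.take x.length, y[x.length], (y.drop (x.length + 1)).map bit ++ v,
      by simp; omega, ?_⟩
    rw [hr, ← List.cons_append, ← List.map_cons, ← List.drop_eq_getElem_cons, ← List.append_assoc,
      ← List.map_append, List.take_append_drop]
  rcases eq_bits_or_exists_mark r with ⟨y, hr⟩ | ⟨y, v, hr⟩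
  · have hy := hshort (v := []) (by simpa using hr)
    have h3 := h12.trans (hrun (v := []) (by simpa using hr) hy)
    rw [hr, hmap]
    rw [hr] at h3 hbound
    have hend : tape (x.map bit ++ mark :: y.map bit) (x.length + 1 + y.length + 1) =
        .rightEnd := tape_eq_rightEnd (by simp; omega)
    by_cases hxy : y.length = x.length
    · have hw := centered_of_length_eq hxy
      have h4 : (palindromeMachine k).Within (x.map bit ++ mark :: y.map bit) 1
          (config k countDown (x.length + 1 + y.length + 1) (x.length - y.length) 0)
          (config k seek (pos x.length true x.length) 0 0) := by
        refine step (d := -1) (da := 0) (db := 0) ?_ (by simp [pos, hxy])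
          (by simp [pos, hxy]; omega)
          (by simp [hxy]) (by simp)
        rw [hend]
        simp [hxy, next]
      have h5 := hw.seek_run (k := k) x.length le_rfl
      have h6 := hw.decides_agree (k := k) hl (i := false) (Nat.zero_le _)
        (fun d h1 h2 => by omega)
      rw [agree_iff hxy] at h6
      refine (((h3.trans h4).trans h5).decides h6).mono ?_
      set n := (x.map bit ++ mark :: y.map bit).length with hn
      have hn' : n = 2 * x.length + 1 := hw.length_eq
      have h7 : (x.length - 0) / l ≤ n / l := Nat.div_le_div_right (by omega)
      calc _ ≤ 60 * (n + 5) + 60 * (n + 5) * (2 ^ l + n / l + 1) := by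
            refine add_le_add (by omega) (Nat.mul_le_mul (by omega) ?_)
            rw [Nat.sub_zero]
            omega
        _ = _ := by ring
    · refine (h3.decides (decides_of_next_eq_none (N := 0) ?_ ?_)).mono
        (hbound (by simp; omega))
      · rw [hend]
        rw [decide_eq_false (by omega)]
        rfl
      · refine iff_of_false (by simp) fun h => hxy (by rw [h, List.length_reverse])
  · have hy := hshort hr
    have h3 := h12.trans (hrun hr hy)
    refine (h3.decides (decides_of_next_eq_none (N := 0) ?_ ?_)).mono
      (hbound (by simp [hr]; omega))
    · have := tape_append_cons (x.map bit ++ mark :: y.map bit) .mark v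
      rw [hr, show x.length + 1 + y.length + 1 =
        (x.map bit ++ mark :: y.map bit).length + 1 by simp; omega]
      simp only [List.append_assoc, List.cons_append] at this
      rw [this]
      rfl
    · refine iff_of_false (by simp) fun h => ?_
      have h4 : mark ∈ x.reverse.map bit := by rw [← h, hr]; simp
      simp at h4

end palindromeMachine

/-! ### The time bound. -/

open Filter Asymptotics in
theorem isBigO_blocks :
    (fun n : ℕ => ((60 * (n + 5) * (2 ^ (Nat.log 2 n / 2 + 1) + n / (Nat.log 2 n / 2 + 1) + 2) : ℕ)
      : ℝ)) =O[atTop] fun n : ℕ => (n : ℝ) ^ 2 / Real.log n := by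
  -- The factor 2 comes from `n + 5 ≤ 2 * n`, and 8 = 4 + 2 + 2 from the three summands, each
  -- compared with `n / log n`.
  refine IsBigO.of_bound (60 * 2 * 8) ?_
  filter_upwards [eventually_ge_atTop 5] with n hn
  have hn' : (5 : ℝ) ≤ n := by exact_mod_cast hn
  have hl0 : 0 < Real.log n := Real.log_pos (by linarith)
  rw [Real.norm_of_nonneg (by positivity), Real.norm_of_nonneg (by positivity)]
  -- With `l = s + 1`, the number `2 ^ l` of possible short blocks is only of order `√n`, while `l`
  -- is still of order `log n`.
  set s := Nat.log 2 n / 2 with hs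
  have h1 : ((2 ^ (s + 1) : ℕ) : ℝ) ≤ 4 * (n / Real.log n) := by
    have h2 : ((2 ^ s : ℕ) : ℝ) ≤ √n := by
      refine Real.le_sqrt_of_sq_le ?_
      have : (2 ^ s) ^ 2 ≤ n := by
        rw [← pow_mul]
        exact (Nat.pow_le_pow_right (by norm_num) (by omega)).trans
          (Nat.pow_log_le_self 2 (by omega))
      exact_mod_cast this
    have h3 : Real.log n ≤ 2 * √n := by
      have h4 := Real.log_le_self (Real.sqrt_nonneg n)
      rw [Real.log_sqrt (by positivity)] at h4
      linarith
    rw [← mul_div_assoc, le_div_iff₀ hl0, pow_succ, Nat.cast_mul]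
    calc ((2 ^ s : ℕ) : ℝ) * (2 : ℕ) * Real.log n ≤ √n * (2 : ℕ) * (2 * √n) := by gcongr
      _ = 4 * (√n * √n) := by push_cast; ring
      _ = 4 * n := by rw [Real.mul_self_sqrt (by positivity)]
  have h2 : ((n / (s + 1) : ℕ) : ℝ) ≤ 2 * (n / Real.log n) := by
    refine Nat.cast_div_le.trans ?_
    rw [← mul_div_assoc, div_le_div_iff₀ (by positivity) hl0]
    have h3 : n ≤ 2 ^ (2 * (s + 1)) :=
      (Nat.lt_pow_succ_log_self (by norm_num) n).le.trans
        (Nat.pow_le_pow_right (by norm_num) (by omega))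
    have h4 : Real.log n ≤ 2 * (s + 1) := by
      have h5 := Real.log_le_log (by linarith) (Nat.cast_le (α := ℝ).2 h3)
      rw [Nat.cast_pow, Real.log_pow] at h5
      push_cast at h5
      refine h5.trans (mul_le_of_le_one_right (by positivity) ?_)
      linarith [Real.log_two_lt_d9]
    push_cast
    nlinarith
  have h3 : 2 ≤ 2 * (n / Real.log n) := by
    have : 1 ≤ n / Real.log n := (one_le_div hl0).2 (Real.log_le_self (by linarith))
    linarith
  have h4 : (n : ℝ) ^ 2 / Real.log n = n * (n / Real.log n) := by ring
  rw [h4]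
  push_cast at h1 h2 ⊢
  calc (60 * (n + 5) * (2 ^ (s + 1) + ((n / (s + 1) : ℕ) : ℝ) + 2) : ℝ)
      ≤ 60 * (2 * n) * (8 * (n / Real.log n)) := by
        gcongr
        · linarith
        · linarith
    _ = _ := by ring

theorem mainTheorem5 (k : ℕ) (hk : 2 ≤ k) :
    (∃ (M : CounterMachine MarkedLetter k) (T : ℕ → ℝ),
      T =O[Filter.atTop] (fun n : ℕ => (n : ℝ) ^ 2 / Real.log n) ∧
      M.Deterministic ∧ M.language = markedPalindromes ∧ M.HaltsWithin T) ∧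
    (∀ T : ℕ → ℝ, T =O[Filter.atTop] (fun n : ℕ => (n : ℝ) ^ 2 / Real.log n) →
      ∃ c : ℝ, 0 < c ∧ ∀ M : CounterMachine MarkedLetter k, M.language = markedPalindromes →
        ∀ᶠ n : ℕ in Filter.atTop, Odd n →
          ∃ w ∈ markedPalindromes, w.length = n ∧ ¬ M.AcceptsWithin w ((n : ℝ) + c * T n)) := by
  refine ⟨?_, fun T hT => exists_not_acceptsWithin k hT⟩
  obtain ⟨k, rfl⟩ := Nat.exists_eq_add_of_le' hk
  -- The parameter `l` may depend on the length of the input, since it occurs only in the analysis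
  -- and not in the machine.
  exact ⟨palindromeMachine k, _, isBigO_blocks, palindromeMachine.deterministic,
    palindromeMachine.deterministic.language_eq_and_haltsWithin
      (fun w => palindromeMachine.decides (Nat.succ_pos _) w)
      fun w c d => palindromeMachine.not_step_of_final⟩
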